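/- **Algorithm.** Input: a matrix $X\in\mathbb R^{n\times m}$ with $\operatorname{rank}(X)=n\ge 1$ and an integer $k$ with $n<k\le m$. 1. Take a thin singular value decomposition $X=U\Sigma V^{T}$, $V\in\mathbb R^{m\times n}$, and let $y_1,\dots,y_m\in\mathbb R^n$ be the rows of $V$. Let $e_1,\dots,e_m$ be the standard basis of $\mathbb R^m$. 2. Run dual-set spectral sparsification on $(y_i)$, $(e_i)$, $k$. Put $\delta=\frac{1+\sqrt{m/k}}{1-\sqrt{n/k}}$, $s=0\in\mathbb R^m$, $A=0_{n\times n}$, $B=0_{m\times m}$. For $\tau=0,1,\dots,k-1$: let $L=\tau-\sqrt{nk}$ and $T=\delta(\tau+\sqrt{mk})$; for each $j$ put $$\mathrm{lo}_j=\frac{y_j^T(A-(L+1)I)^{-2}y_j}{\operatorname{tr}(A-(L+1)I)^{-1}-\operatorname{tr}(A-LI)^{-1}}-y_j^T(A-(L+1)I)^{-1}y_j,$$ $$\mathrm{up}_j=\frac{e_j^T((T+\delta)I-B)^{-2}e_j}{\operatorname{tr}(TI-B)^{-1}-\operatorname{tr}((T+\delta)I-B)^{-1}}+e_j^T((T+\delta)I-B)^{-1}e_j;$$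 pick an index $j$ with $\mathrm{up}_j\le\mathrm{lo}_j$, let $t=2/(\mathrm{up}_j+\mathrm{lo}_j)$, and replace $s_j$ by $s_j+t$, $A$ by $A+t\,y_jy_j^T$, $B$ by $B+t\,e_je_j^T$. At the end multiply $s$ by $\frac1k\bigl(1-\sqrt{n/k}\bigr)$. 3. Return $S=\{i: s_i\ne 0\}$. **Theorem.** Let $X\in\mathbb R^{n\times m}$ with $\operatorname{rank}(X)=n\ge1$ and let $n<k\le m$. The algorithm needs $O(kmn^2)$ operations and deterministically constructs a set $S\subseteq\{1,\dots,m\}$ with $|S|\le k$, $\operatorname{rank}(X_S)=n$ and, for both the spectral norm ($\xi=2$) and the Frobenius norm ($\xi=\mathrm F$), $$\|X_S^{\dagger}\|_\xi^2\le\Bigl(1+\sqrt{m/k}\Bigr)^2\Bigl(1-\sqrt{n/k}\Bigr)^{-2}\|X^{\dagger}\|_\xi^2 ,$$ where $X_S$ consists of the columns of $X$ with index in $S$ and $\dagger$ is the Moore–Penrose pseudo-inverse. In detail: $X$ has a thin singular value decomposition, and for every such decomposition and every admissible choice of the indices $j$, the returned set $S$ has the stated properties. Moreover there are one deterministic real random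 access machine program (exact arithmetic; $+,-,\times,/,\sqrt{\ },\le$ on reals, index arithmetic, assignments and loop iterations at unit cost; no singular value decomposition as a primitive) and an absolute constant $C$ such that, for all $n,m,k,X$ as above, the program stops on input $(X,k)$ after at most $C\,k\,m\,n^2$ operations and returns a set that is a possible output of the algorithm for every choice of the singular value decomposition in step 1. -/

import Mathlib

open scoped Matrix

/-! ### Norms, column submatrices, pseudo-inverse -/

section Matrices

variable {ι κ : Type*} [Fintype ι] [Fintype κ]

/-- The spectral norm, i.e. the operator norm with respect to the Euclidean norms. -/
noncomputable def spectralNorm₂ (A : Matrix ι κ ℝ) : ℝ :=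
  letI := Classical.decEq κ
  ‖(Matrix.toEuclideanLin A).toContinuousLinearMap‖

/-- The Frobenius norm. -/
noncomputable def frobeniusNorm (A : Matrix ι κ ℝ) : ℝ :=
  √(∑ i, ∑ j, A i j ^ 2)

/-- The submatrix of the columns of `X` with index in `S`. -/
def colSubmatrix {m : ℕ} (X : Matrix ι (Fin m) ℝ) (S : Finset (Fin m)) :
    Matrix ι {j // j ∈ S} ℝ :=
  X.submatrix id Subtype.val

/-- The four Penrose equations. -/
structure IsMoorePenrose (A : Matrix ι κ ℝ) (P : Matrix κ ι ℝ) : Prop where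
  mul_mul_self : A * P * A = A
  mul_mul_inv : P * A * P = P
  symm_left : (A * P)ᵀ = A * P
  symm_right : (P * A)ᵀ = P * A

theorem IsMoorePenrose.unique {A : Matrix ι κ ℝ} {P Q : Matrix κ ι ℝ}
    (hP : IsMoorePenrose A P) (hQ : IsMoorePenrose A Q) : P = Q := by
  have h1 : A * P = A * Q := by
    have e : A * P = (A * Q) * (A * P) := by
      rw [← Matrix.mul_assoc, hQ.mul_mul_self]
    have e2 : (A * P)ᵀ = (A * P)ᵀ * (A * Q)ᵀ := by
      conv_lhs => rw [e]
      rw [Matrix.transpose_mul]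
    rw [hP.symm_left, hQ.symm_left, ← Matrix.mul_assoc, hP.mul_mul_self] at e2
    exact e2
  have h2 : P * A = Q * A := by
    have e : P * A = (P * A) * (Q * A) := by
      rw [Matrix.mul_assoc, ← Matrix.mul_assoc A, hQ.mul_mul_self]
    have e2 : (P * A)ᵀ = (Q * A)ᵀ * (P * A)ᵀ := by
      conv_lhs => rw [e]
      rw [Matrix.transpose_mul]
    rw [hP.symm_right, hQ.symm_right, Matrix.mul_assoc, ← Matrix.mul_assoc A,
      hP.mul_mul_self] at e2
    exact e2
  calc P = P * A * P := hP.mul_mul_inv.symm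
    _ = Q * (A * P) := by rw [h2, Matrix.mul_assoc]
    _ = Q * A * Q := by rw [h1, Matrix.mul_assoc]
    _ = Q := hQ.mul_mul_inv

theorem IsMoorePenrose.exists (A : Matrix ι κ ℝ) : ∃ P, IsMoorePenrose A P := by
  classical
  have hH : (Aᵀ * A).IsHermitian := by
    simpa using Matrix.isHermitian_conjTranspose_mul_self A
  set E : Matrix κ κ ℝ := (hH.eigenvectorUnitary : Matrix κ κ ℝ) with hE
  set l := hH.eigenvalues with hl
  have hEE : Eᵀ * E = 1 := by
    have := Matrix.UnitaryGroup.star_mul_self hH.eigenvectorUnitary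
    simpa [Matrix.star_eq_conjTranspose] using this
  have hspec : Aᵀ * A = E * Matrix.diagonal l * Eᵀ := by
    have := hH.spectral_theorem
    simpa [Unitary.conjStarAlgAut_apply, Matrix.star_eq_conjTranspose] using this
  set K := E * Matrix.diagonal (fun i => (l i)⁻¹) * Eᵀ with hK
  have key : ∀ a b : κ → ℝ, (E * Matrix.diagonal a * Eᵀ) * (E * Matrix.diagonal b * Eᵀ)
      = E * Matrix.diagonal (fun i => a i * b i) * Eᵀ := by
    intro a b
    calc _ = E * Matrix.diagonal a * (Eᵀ * E) * (Matrix.diagonal b * Eᵀ) := by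
          simp only [Matrix.mul_assoc]
      _ = _ := by
          rw [hEE, Matrix.mul_one, ← Matrix.mul_assoc, Matrix.mul_assoc E,
            Matrix.diagonal_mul_diagonal]
  have symm : ∀ a : κ → ℝ, (E * Matrix.diagonal a * Eᵀ)ᵀ = E * Matrix.diagonal a * Eᵀ := by
    intro a
    simp [Matrix.transpose_mul, Matrix.mul_assoc]
  have cancel : ∀ x : ℝ, x * x⁻¹ * x = x := fun x => by
    by_cases h : x = 0 <;> simp [h]
  have cancel' : ∀ x : ℝ, x⁻¹ * x * x⁻¹ = x⁻¹ := fun x => by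
    by_cases h : x = 0 <;> simp [h]
  have hHKH : (Aᵀ * A) * K * (Aᵀ * A) = Aᵀ * A := by
    rw [hspec, hK, key, key]; simp only [cancel]
  have hKHK : K * (Aᵀ * A) * K = K := by
    rw [hspec, hK, key, key]; simp only [cancel']
  have hKsymm : Kᵀ = K := symm _
  have hKH : (K * (Aᵀ * A))ᵀ = K * (Aᵀ * A) := by
    rw [hspec, hK, key]; exact symm _
  have hAK : A * (K * (Aᵀ * A)) = A := by
    have hz : (A * (K * (Aᵀ * A)) - A)ᵀ * (A * (K * (Aᵀ * A)) - A) = 0 := by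
      have e1 : (A * (K * (Aᵀ * A)) - A)ᵀ * A = 0 := by
        rw [Matrix.transpose_sub, Matrix.sub_mul, Matrix.transpose_mul, hKH,
          ← hKH, Matrix.transpose_mul, hKsymm, Matrix.transpose_mul, Matrix.transpose_transpose,
          sub_eq_zero]
        rw [Matrix.mul_assoc, hHKH]
      rw [Matrix.mul_sub, ← Matrix.mul_assoc, e1, Matrix.zero_mul, sub_zero]
    have hz' : (A * (K * (Aᵀ * A)) - A)ᴴ * (A * (K * (Aᵀ * A)) - A) = 0 := by simpa using hz
    exact sub_eq_zero.1 (Matrix.conjTranspose_mul_self_eq_zero.1 hz')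
  refine ⟨K * Aᵀ, ?_, ?_, ?_, ?_⟩
  · rw [Matrix.mul_assoc, Matrix.mul_assoc K, hAK]
  · calc K * Aᵀ * A * (K * Aᵀ) = K * (Aᵀ * A) * K * Aᵀ := by simp only [Matrix.mul_assoc]
      _ = _ := by rw [hKHK]
  · simp only [Matrix.transpose_mul, Matrix.transpose_transpose, hKsymm, Matrix.mul_assoc]
  · rw [Matrix.mul_assoc]; exact hKH

/-- The Moore-Penrose pseudo-inverse: the unique solution of the Penrose equations. -/
noncomputable def pinv (A : Matrix ι κ ℝ) : Matrix κ ι ℝ :=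
  Classical.choose (IsMoorePenrose.exists A)

theorem pinv_spec (A : Matrix ι κ ℝ) : IsMoorePenrose A (pinv A) :=
  Classical.choose_spec (IsMoorePenrose.exists A)

end Matrices

/-- `X = U diag(σ) Vᵀ` is a thin singular value decomposition of the `n × m` matrix `X` of
rank `r`. -/
structure IsThinSVD {n m r : ℕ} (X : Matrix (Fin n) (Fin m) ℝ) (U : Matrix (Fin n) (Fin r) ℝ)
    (σ : Fin r → ℝ) (V : Matrix (Fin m) (Fin r) ℝ) : Prop where
  left_orthonormal : Uᵀ * U = 1
  right_orthonormal : Vᵀ * V = 1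
  antitone : Antitone σ
  pos : ∀ i, 0 < σ i
  eq : X = U * Matrix.diagonal σ * Vᵀ

/-- `V` is a matrix of right singular vectors of `X`, for the nonzero singular values. -/
def IsRightSingularMatrix {n m r : ℕ} (X : Matrix (Fin n) (Fin m) ℝ)
    (V : Matrix (Fin m) (Fin r) ℝ) : Prop :=
  ∃ (U : Matrix (Fin n) (Fin r) ℝ) (σ : Fin r → ℝ), IsThinSVD X U σ V

/-! ### Dual set spectral sparsification -/

namespace DualSet

/-- The lower barrier potential `φ(L, A) = tr (A - L I)⁻¹`. -/
noncomputable def lowerPotential {n : ℕ} (L : ℝ) (A : Matrix (Fin n) (Fin n) ℝ) : ℝ :=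
  (A - L • (1 : Matrix (Fin n) (Fin n) ℝ))⁻¹.trace

/-- The upper barrier potential `φ'(T, B) = tr (T I - B)⁻¹`. -/
noncomputable def upperPotential {l : ℕ} (T : ℝ) (B : Matrix (Fin l) (Fin l) ℝ) : ℝ :=
  (T • (1 : Matrix (Fin l) (Fin l) ℝ) - B)⁻¹.trace

/-- With `M = A - (L + δ) I`, the number
`vᵀ M⁻² v / (φ(L + δ, A) - φ(L, A)) - vᵀ M⁻¹ v`. -/
noncomputable def lowerGain {n : ℕ} (v : Fin n → ℝ) (δ : ℝ) (A : Matrix (Fin n) (Fin n) ℝ)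
    (L : ℝ) : ℝ :=
  let N := (A - (L + δ) • (1 : Matrix (Fin n) (Fin n) ℝ))⁻¹
  (v ⬝ᵥ ((N * N) *ᵥ v)) / (lowerPotential (L + δ) A - lowerPotential L A) - v ⬝ᵥ (N *ᵥ v)

/-- With `M = (T + δ) I - B`, the number
`uᵀ M⁻² u / (φ'(T, B) - φ'(T + δ, B)) + uᵀ M⁻¹ u`. -/
noncomputable def upperGain {l : ℕ} (u : Fin l → ℝ) (δ : ℝ) (B : Matrix (Fin l) (Fin l) ℝ)
    (T : ℝ) : ℝ :=
  let N := ((T + δ) • (1 : Matrix (Fin l) (Fin l) ℝ) - B)⁻¹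
  (u ⬝ᵥ ((N * N) *ᵥ u)) / (upperPotential T B - upperPotential (T + δ) B) + u ⬝ᵥ (N *ᵥ u)

/-- The data maintained by the algorithm: the weights `s`, and the matrices
`A = ∑ sᵢ vᵢ vᵢᵀ` and `B = ∑ sᵢ uᵢ uᵢᵀ`. -/
structure State (m n l : ℕ) where
  s : Fin m → ℝ
  A : Matrix (Fin n) (Fin n) ℝ
  B : Matrix (Fin l) (Fin l) ℝ

/-- The upper increment `(1 + √(l/k)) / (1 - √(n/k))`; the lower increment is `1`. -/
noncomputable def upperStep (n l k : ℕ) : ℝ :=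
  (1 + √((l : ℝ) / k)) / (1 - √((n : ℝ) / k))

/-- Iteration number `τ = 0, 1, …, k - 1`. Any index whose upper gain does not exceed its
lower gain may be picked. -/
def IsStep {m n l : ℕ} (v : Fin m → Fin n → ℝ) (u : Fin m → Fin l → ℝ) (k τ : ℕ)
    (st st' : State m n l) : Prop :=
  ∃ j : Fin m,
    let lo := lowerGain (v j) 1 st.A ((τ : ℝ) - √((n : ℝ) * k))
    let up := upperGain (u j) (upperStep n l k) st.B (upperStep n l k * ((τ : ℝ) + √((l : ℝ) * k)))
    let t := ((up + lo) / 2)⁻¹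
    up ≤ lo ∧
    st' = { s := st.s + Pi.single j t
            A := st.A + t • Matrix.vecMulVec (v j) (v j)
            B := st.B + t • Matrix.vecMulVec (u j) (u j) }

/-- `s` is a vector of weights returned by the dual set spectral sparsification algorithm on
`v₁, …, vₘ ∈ ℝⁿ`, `u₁, …, uₘ ∈ ℝˡ` and `k`: start from zero, perform `k` iterations, and rescale. -/
def IsOutput {m n l : ℕ} (v : Fin m → Fin n → ℝ) (u : Fin m → Fin l → ℝ) (k : ℕ)
    (s : Fin m → ℝ) : Prop :=
  ∃ st : ℕ → State m n l,
    st 0 = { s := 0, A := 0, B := 0 } ∧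
    (∀ τ < k, IsStep v u k τ (st τ) (st (τ + 1))) ∧
    s = ((1 - √((n : ℝ) / k)) / k) • (st k).s

end DualSet

/-- `S` is a set returned by the greedy selection algorithm when the right singular vectors
computed in its first line are the columns of `V`: the dual set algorithm is run on the rows of `V`
and the standard basis, and the support of the weights is returned. -/
def IsGreedySelection {m n : ℕ} (V : Matrix (Fin m) (Fin n) ℝ) (k : ℕ) (S : Finset (Fin m)) :
    Prop :=
  ∃ s : Fin m → ℝ,
    DualSet.IsOutput (fun i => V i) (fun i : Fin m => (Pi.single i 1 : Fin m → ℝ)) k s ∧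
    ∀ i, i ∈ S ↔ s i ≠ 0

/-! ### A real random access machine

Programs use natural-number registers (for indices) and two-dimensional arrays of real numbers.
Each evaluation of a literal, register or array cell, each arithmetic operation, square root,
comparison, assignment and loop iteration is charged one unit. -/

namespace RealRAM

/-- Index expressions. -/
inductive NExp where
  | lit (c : ℕ)
  | var (x : ℕ)
  | add (e₁ e₂ : NExp)

/-- Real expressions; `sum x d e` is the sum of `e` over `x = 0, …, d - 1`. -/
inductive RExp where
  | ofNat (e : NExp)
  | cell (a : ℕ) (i j : NExp)
  | add (e₁ e₂ : RExp)
  | sub (e₁ e₂ : RExp)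
  | mul (e₁ e₂ : RExp)
  | div (e₁ e₂ : RExp)
  | sqrt (e : RExp)
  | sum (x : ℕ) (d : NExp) (e : RExp)

/-- Programs; `loop x d c` runs `c` for `x = 0, …, d - 1`. -/
inductive Prog where
  | skip
  | setN (x : ℕ) (e : NExp)
  | setR (a : ℕ) (i j : NExp) (e : RExp)
  | seq (c₁ c₂ : Prog)
  | ifLe (e₁ e₂ : RExp) (c₁ c₂ : Prog)
  | loop (x : ℕ) (d : NExp) (c : Prog)

/-- Contents of the registers and of the arrays (array name, row, column). -/
structure Store where
  reg : ℕ → ℕ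
  arr : ℕ → ℕ → ℕ → ℝ

def Store.setReg (s : Store) (x v : ℕ) : Store :=
  { s with reg := Function.update s.reg x v }

def Store.setCell (s : Store) (a i j : ℕ) (r : ℝ) : Store :=
  { s with arr := fun a' i' j' => if a' = a ∧ i' = i ∧ j' = j then r else s.arr a' i' j' }

def NExp.eval (s : Store) : NExp → ℕ
  | lit c => c
  | var x => s.reg x
  | add e₁ e₂ => e₁.eval s + e₂.eval s

def NExp.cost : NExp → ℕ
  | lit _ => 1
  | var _ => 1
  | add e₁ e₂ => e₁.cost + e₂.cost + 1

noncomputable def RExp.eval : RExp → Store → ℝ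
  | ofNat e, s => (e.eval s : ℝ)
  | cell a i j, s => s.arr a (i.eval s) (j.eval s)
  | add e₁ e₂, s => e₁.eval s + e₂.eval s
  | sub e₁ e₂, s => e₁.eval s - e₂.eval s
  | mul e₁ e₂, s => e₁.eval s * e₂.eval s
  | div e₁ e₂, s => e₁.eval s / e₂.eval s
  | sqrt e, s => √(e.eval s)
  | sum x d e, s => ∑ i ∈ Finset.range (d.eval s), e.eval (s.setReg x i)

def RExp.cost : RExp → Store → ℕ
  | ofNat e, _ => e.cost + 1
  | cell _ i j, _ => i.cost + j.cost + 1
  | add e₁ e₂, s => e₁.cost s + e₂.cost s + 1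
  | sub e₁ e₂, s => e₁.cost s + e₂.cost s + 1
  | mul e₁ e₂, s => e₁.cost s + e₂.cost s + 1
  | div e₁ e₂, s => e₁.cost s + e₂.cost s + 1
  | sqrt e, s => e.cost s + 1
  | sum x d e, s => d.cost + 1 + ∑ i ∈ Finset.range (d.eval s), (e.cost (s.setReg x i) + 2)

open Classical in
/-- The final store and the number of operations performed. -/
noncomputable def Prog.run : Prog → Store → Store × ℕ
  | skip, s => (s, 1)
  | setN x e, s => (s.setReg x (e.eval s), e.cost + 1)
  | setR a i j e, s =>
      (s.setCell a (i.eval s) (j.eval s) (e.eval s), i.cost + j.cost + e.cost s + 1)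
  | seq c₁ c₂, s =>
      let p := c₁.run s
      let q := c₂.run p.1
      (q.1, p.2 + q.2)
  | ifLe e₁ e₂ c₁ c₂, s =>
      let q := if e₁.eval s ≤ e₂.eval s then c₁.run s else c₂.run s
      (q.1, e₁.cost s + e₂.cost s + 1 + q.2)
  | loop x d c, s =>
      (List.range (d.eval s)).foldl
        (fun p i =>
          let q := c.run (p.1.setReg x i)
          (q.1, p.2 + q.2 + 1))
        (s, d.cost + 1)

/-- The initial store: `n`, `m`, `k` in the registers `0`, `1`, `2`, the matrix `X` in array `0`,
and zeros everywhere else. -/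
noncomputable def initStore {n m : ℕ} (X : Matrix (Fin n) (Fin m) ℝ) (k : ℕ) : Store where
  reg x := if x = 0 then n else if x = 1 then m else if x = 2 then k else 0
  arr a i j := if h : a = 0 ∧ i < n ∧ j < m then X ⟨i, h.2.1⟩ ⟨j, h.2.2⟩ else 0

open Classical in
/-- The set returned by a program: the indices of the nonzero entries of column `0` of array `1`. -/
noncomputable def Prog.output (P : Prog) {n m : ℕ} (X : Matrix (Fin n) (Fin m) ℝ) (k : ℕ) :
    Finset (Fin m) :=
  Finset.univ.filter fun j => (P.run (initStore X k)).1.arr 1 j 0 ≠ 0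

/-- The number of operations performed on input `X`, `k`. -/
noncomputable def Prog.opCount (P : Prog) {n m : ℕ} (X : Matrix (Fin n) (Fin m) ℝ) (k : ℕ) : ℕ :=
  (P.run (initStore X k)).2

end RealRAM

/-! ### Spectral calculus for symmetric matrices -/

section Spectral

open Matrix

variable {n : ℕ}

/-! The quality of the selected columns comes from a two-sided barrier argument. Let `A = Vᵀ diag(s)
V`. A lower barrier `L` stays below the spectrum of `A` and an upper barrier `T` stays above all
weights. In every iteration `L` advances by `1` and `T` by `δ`, while the potentials `tr (A - L)⁻¹`
and `∑ (T - sᵢ)⁻¹` never increase. By the Sherman–Morrison formula, adding weight `t` at `j` keeps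
the lower potential in check if `t⁻¹` is at most the lower gain of `j`; a scalar computation does
the same for the upper potential if `t⁻¹` is at least the upper gain. Since `VᵀV = 1`, the gains can
be summed over `j` (`le_sum_lowerGain`, `sum_upperGain_le`), and `δ` is chosen so that the sum of
the upper gains is at most `1 - √(n/k)`, which is at most the sum of the lower gains. Hence an
admissible index exists at every step.

After `k` iterations the two barriers give `‖Vz‖² ≤ c ∑_{i ∈ S} (Vz)ᵢ²`, where `c` is their ratio.
As `X = R Vᵀ` with `R` invertible, this becomes `‖Xᵀz‖² ≤ c ‖X_Sᵀz‖²`. A duality argument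
(`pinv_mulVec_norm_sq_le`) turns it into `‖X_S† w‖² ≤ c ‖X† w‖²` for every `w`, which yields both
norm bounds.

For the program, conjugation by `R` expresses the lower gains through `X diag(s - c) Xᵀ` alone
(`lowerGain_eq_gainMatrix`). The gains therefore do not depend on the decomposition, and none has to
be computed. The matrices to be inverted are positive definite, so replacing the rows of the
identity one by one needs no pivoting (`isUnit_topRows`). One iteration costs `O(m n²)`: Gram
matrices and quadratic forms take `m n²`, inversions `n³ ≤ m n²`, and the upper gains, all scalar,
`O(m)`. -/

theorem exists_orthogonal_diagonalization {A : Matrix (Fin n) (Fin n) ℝ} (hA : A.IsHermitian) :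
    ∃ (E : Matrix (Fin n) (Fin n) ℝ) (l : Fin n → ℝ),
      Eᵀ * E = 1 ∧ E * Eᵀ = 1 ∧ A = E * diagonal l * Eᵀ := by
  refine ⟨hA.eigenvectorUnitary, hA.eigenvalues, ?_, ?_, ?_⟩
  · have := Matrix.UnitaryGroup.star_mul_self hA.eigenvectorUnitary
    simpa [Matrix.star_eq_conjTranspose] using this
  · have := Unitary.coe_mul_star_self hA.eigenvectorUnitary
    simpa [Matrix.star_eq_conjTranspose] using this
  · have := hA.spectral_theorem
    simpa [Unitary.conjStarAlgAut_apply, Matrix.star_eq_conjTranspose] using this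

theorem orthogonal_conj_mul {E : Matrix (Fin n) (Fin n) ℝ} (hE : Eᵀ * E = 1)
    (M N : Matrix (Fin n) (Fin n) ℝ) :
    (E * M * Eᵀ) * (E * N * Eᵀ) = E * (M * N) * Eᵀ := by
  calc _ = E * M * (Eᵀ * E) * (N * Eᵀ) := by simp only [Matrix.mul_assoc]
    _ = _ := by rw [hE, Matrix.mul_one]; simp only [Matrix.mul_assoc]

theorem orthogonal_conj_sub_smul_one {E : Matrix (Fin n) (Fin n) ℝ} (hE : E * Eᵀ = 1)
    (l : Fin n → ℝ) (c : ℝ) :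
    E * diagonal l * Eᵀ - c • (1 : Matrix (Fin n) (Fin n) ℝ)
      = E * diagonal (fun i => l i - c) * Eᵀ := by
  have h : (diagonal fun i => l i - c) = diagonal l - c • (1 : Matrix (Fin n) (Fin n) ℝ) := by
    rw [smul_one_eq_diagonal, diagonal_sub]
  rw [h, Matrix.mul_sub, Matrix.sub_mul, Matrix.mul_smul, Matrix.smul_mul, Matrix.mul_one, hE]

theorem orthogonal_conj_inv {E : Matrix (Fin n) (Fin n) ℝ} (hE : Eᵀ * E = 1) (hE' : E * Eᵀ = 1)
    {d : Fin n → ℝ} (hd : ∀ i, d i ≠ 0) :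
    (E * diagonal d * Eᵀ)⁻¹ = E * diagonal (fun i => (d i)⁻¹) * Eᵀ := by
  refine Matrix.inv_eq_right_inv ?_
  rw [orthogonal_conj_mul hE, diagonal_mul_diagonal]
  simp [hd, hE']

theorem orthogonal_conj_trace {E : Matrix (Fin n) (Fin n) ℝ} (hE : Eᵀ * E = 1) (d : Fin n → ℝ) :
    (E * diagonal d * Eᵀ).trace = ∑ i, d i := by
  rw [Matrix.trace_mul_comm, ← Matrix.mul_assoc, hE, Matrix.one_mul, trace_diagonal]

theorem posDef_orthogonal_conj_diagonal_iff {E : Matrix (Fin n) (Fin n) ℝ} (hE : Eᵀ * E = 1)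
    (d : Fin n → ℝ) : (E * diagonal d * Eᵀ).PosDef ↔ ∀ i, 0 < d i := by
  have hU : IsUnit E := IsUnit.of_mul_eq_one_right _ hE
  have := Matrix.IsUnit.posDef_star_right_conjugate_iff (x := diagonal d) hU
  rw [Matrix.star_eq_conjTranspose, conjTranspose_eq_transpose_of_trivial] at this
  rw [this, posDef_diagonal_iff]

end Spectral

namespace DualSet

open Matrix

/-! ### The averaging inequalities -/

/-- Write `φ = ∑ aᵢ⁻¹`, `D = ∑ (aᵢ(aᵢ-1))⁻¹` and `F = ∑ (aᵢ(aᵢ-1)²)⁻¹`. Then `∑ (aᵢ-1)⁻¹ = φ + D`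
and `∑ (aᵢ-1)⁻² = D + F`, so the claim reduces to `D² ≤ F`. This follows from Cauchy–Schwarz, `D² ≤
φ F`, and `φ ≤ 1`. -/
theorem lower_averaging {n : ℕ} (hn : 0 < n) {a : Fin n → ℝ} (ha : ∀ i, 1 < a i)
    (hsum : ∑ i, (a i)⁻¹ ≤ 1) :
    1 - ∑ i, (a i)⁻¹ ≤ (∑ i, (a i - 1)⁻¹ * (a i - 1)⁻¹) /
      (∑ i, (a i - 1)⁻¹ - ∑ i, (a i)⁻¹) - ∑ i, (a i - 1)⁻¹ := by
  have : Nonempty (Fin n) := ⟨⟨0, hn⟩⟩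
  have h1 : ∀ i, 0 < a i := fun i => one_pos.trans (ha i)
  have h2 : ∀ i, 0 < a i - 1 := fun i => sub_pos.2 (ha i)
  have hD : ∑ i, (a i - 1)⁻¹ - ∑ i, (a i)⁻¹ = ∑ i, ((a i) * (a i - 1))⁻¹ := by
    rw [← Finset.sum_sub_distrib]
    refine Finset.sum_congr rfl fun i _ => ?_
    have := (h1 i).ne'; have := (h2 i).ne'
    field_simp; ring
  have hDpos : 0 < ∑ i, ((a i) * (a i - 1))⁻¹ :=
    Finset.sum_pos (fun i _ => inv_pos.2 (mul_pos (h1 i) (h2 i))) Finset.univ_nonempty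
  have hE : ∑ i, (a i - 1)⁻¹ * (a i - 1)⁻¹ - ∑ i, ((a i) * (a i - 1))⁻¹
      = ∑ i, (a i * (a i - 1) ^ 2)⁻¹ := by
    rw [← Finset.sum_sub_distrib]
    refine Finset.sum_congr rfl fun i _ => ?_
    have := (h1 i).ne'; have := (h2 i).ne'
    field_simp; ring
  have hCS : (∑ i, ((a i) * (a i - 1))⁻¹) ^ 2
      ≤ (∑ i, (a i)⁻¹) * ∑ i, (a i * (a i - 1) ^ 2)⁻¹ := by
    refine Finset.sum_sq_le_sum_mul_sum_of_sq_le_mul _ (fun i _ => (inv_pos.2 (h1 i)).le)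
      (fun i _ => (inv_pos.2 (mul_pos (h1 i) (pow_pos (h2 i) 2))).le) fun i _ => le_of_eq ?_
    have := (h1 i).ne'; have := (h2 i).ne'
    field_simp
  have hFnn : 0 ≤ ∑ i, (a i * (a i - 1) ^ 2)⁻¹ :=
    Finset.sum_nonneg fun i _ => (inv_pos.2 (mul_pos (h1 i) (pow_pos (h2 i) 2))).le
  rw [hD, le_sub_iff_add_le, le_div_iff₀ hDpos]
  nlinarith [mul_le_mul_of_nonneg_right hsum hFnn]

/-- Both summands are compared term by term: `(b+δ)⁻² ≤ (b(b+δ))⁻¹`, which is `δ⁻¹` times the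
corresponding term of the denominator, and `(b+δ)⁻¹ ≤ b⁻¹`. -/
theorem upper_averaging {m : ℕ} (hm : 0 < m) {b : Fin m → ℝ} {δ : ℝ} (hδ : 0 < δ)
    (hb : ∀ i, 0 < b i) :
    (∑ i, (b i + δ)⁻¹ * (b i + δ)⁻¹) / (∑ i, (b i)⁻¹ - ∑ i, (b i + δ)⁻¹) + ∑ i, (b i + δ)⁻¹
      ≤ δ⁻¹ + ∑ i, (b i)⁻¹ := by
  have : Nonempty (Fin m) := ⟨⟨0, hm⟩⟩
  have h2 : ∀ i, 0 < b i + δ := fun i => add_pos (hb i) hδ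
  have hD : ∑ i, (b i)⁻¹ - ∑ i, (b i + δ)⁻¹ = ∑ i, δ * (b i * (b i + δ))⁻¹ := by
    rw [← Finset.sum_sub_distrib]
    refine Finset.sum_congr rfl fun i _ => ?_
    have := (hb i).ne'; have := (h2 i).ne'
    field_simp; ring
  have hDpos : 0 < ∑ i, δ * (b i * (b i + δ))⁻¹ :=
    Finset.sum_pos (fun i _ => mul_pos hδ (inv_pos.2 (mul_pos (hb i) (h2 i))))
      Finset.univ_nonempty
  refine add_le_add ?_ (Finset.sum_le_sum fun i _ => ?_)
  · rw [hD, div_le_iff₀ hDpos, Finset.mul_sum]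
    refine Finset.sum_le_sum fun i _ => ?_
    rw [← mul_assoc, inv_mul_cancel₀ hδ.ne', one_mul, ← mul_inv]
    exact inv_anti₀ (mul_pos (hb i) (h2 i)) (mul_le_mul_of_nonneg_right (by linarith) (h2 i).le)
  · exact inv_anti₀ (hb i) (by linarith)

/-! ### Rank-one updates -/

/-- Sherman–Morrison: the coefficient `c = t/(1+tq)` is the solution of `c + c·tq = t`, which makes
the rank-one terms cancel. -/
theorem inv_add_smul_vecMulVec {n : ℕ} {M : Matrix (Fin n) (Fin n) ℝ} (hM : IsUnit M.det)
    (v : Fin n → ℝ) (t : ℝ) (h : 1 + t * (v ⬝ᵥ (M⁻¹ *ᵥ v)) ≠ 0) :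
    (M + t • vecMulVec v v)⁻¹
      = M⁻¹ - (t / (1 + t * (v ⬝ᵥ (M⁻¹ *ᵥ v)))) • (M⁻¹ * vecMulVec v v * M⁻¹) := by
  refine Matrix.inv_eq_right_inv ?_
  set q := v ⬝ᵥ (M⁻¹ *ᵥ v) with hq
  have e1 : vecMulVec v v * (M⁻¹ * vecMulVec v v * M⁻¹) = q • (vecMulVec v v * M⁻¹) := by
    rw [← Matrix.mul_assoc, mul_vecMulVec, vecMulVec_mul_vecMulVec, ← hq, vecMulVec_smul,
      Matrix.smul_mul]
  have e2 : M * (M⁻¹ * vecMulVec v v * M⁻¹) = vecMulVec v v * M⁻¹ := by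
    rw [Matrix.mul_assoc, ← Matrix.mul_assoc, Matrix.mul_nonsing_inv _ hM, Matrix.one_mul]
  rw [Matrix.add_mul, Matrix.mul_sub, Matrix.mul_sub, Matrix.mul_nonsing_inv _ hM,
    Matrix.mul_smul, e2, Matrix.mul_smul, Matrix.smul_mul, Matrix.smul_mul, e1, smul_smul,
    smul_smul]
  have : t / (1 + t * q) + t / (1 + t * q) * (t * q) = t := by field_simp
  have e3 : ∀ Z : Matrix (Fin n) (Fin n) ℝ,
      1 - (t / (1 + t * q)) • Z + (t • Z - ((t / (1 + t * q)) * (t * q)) • Z) = 1 := by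
    intro Z
    have : t • Z = (t / (1 + t * q)) • Z + (t / (1 + t * q) * (t * q)) • Z := by
      rw [← add_smul, this]
    rw [this]; abel
  convert e3 (vecMulVec v v * M⁻¹) using 3
  rw [mul_assoc]

theorem trace_inv_add_smul_vecMulVec {n : ℕ} {M : Matrix (Fin n) (Fin n) ℝ} (hM : IsUnit M.det)
    (v : Fin n → ℝ) (t : ℝ) (h : 1 + t * (v ⬝ᵥ (M⁻¹ *ᵥ v)) ≠ 0) :
    (M + t • vecMulVec v v)⁻¹.trace
      = M⁻¹.trace
        - t * (v ⬝ᵥ ((M⁻¹ * M⁻¹) *ᵥ v)) / (1 + t * (v ⬝ᵥ (M⁻¹ *ᵥ v))) := by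
  rw [inv_add_smul_vecMulVec hM v t h, trace_sub, trace_smul, Matrix.trace_mul_comm,
    ← Matrix.mul_assoc, mul_vecMulVec, trace_vecMulVec, dotProduct_comm _ v, smul_eq_mul]
  ring

end DualSet

namespace DualSet

open Matrix

/-! ### The lower barrier -/

theorem lowerPotential_orthogonal_conj {n : ℕ} {E : Matrix (Fin n) (Fin n) ℝ} (hE : Eᵀ * E = 1)
    (hE' : E * Eᵀ = 1) {l : Fin n → ℝ} {c : ℝ} (hc : ∀ i, c < l i) :
    lowerPotential c (E * diagonal l * Eᵀ) = ∑ i, (l i - c)⁻¹ := by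
  rw [lowerPotential, orthogonal_conj_sub_smul_one hE',
    orthogonal_conj_inv hE hE' fun i => (sub_pos.2 (hc i)).ne', orthogonal_conj_trace hE]

/-- Each term `(lᵢ - L)⁻¹` is at most the whole potential, hence less than `1`. So the barrier can
move by a full unit without reaching an eigenvalue. -/
theorem exists_diagonalization_of_lowerPotential_lt_one {n : ℕ} {A : Matrix (Fin n) (Fin n) ℝ}
    {L : ℝ} (hA : (A - L • (1 : Matrix (Fin n) (Fin n) ℝ)).PosDef)
    (hφ : lowerPotential L A < 1) :
    ∃ (E : Matrix (Fin n) (Fin n) ℝ) (l : Fin n → ℝ), Eᵀ * E = 1 ∧ E * Eᵀ = 1 ∧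
      A = E * diagonal l * Eᵀ ∧ ∀ i, L + 1 < l i := by
  have hH : A.IsHermitian := by
    have h1 : (L • (1 : Matrix (Fin n) (Fin n) ℝ)).IsHermitian := by
      rw [Matrix.IsHermitian, conjTranspose_smul, conjTranspose_one, star_trivial]
    simpa using hA.1.add h1
  obtain ⟨E, l, hE, hE', rfl⟩ := exists_orthogonal_diagonalization hH
  have hl : ∀ i, L < l i := by
    rw [orthogonal_conj_sub_smul_one hE', posDef_orthogonal_conj_diagonal_iff hE] at hA
    exact fun i => sub_pos.1 (hA i)
  refine ⟨E, l, hE, hE', rfl, fun i => ?_⟩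
  rw [lowerPotential_orthogonal_conj hE hE' hl] at hφ
  have h1 : (l i - L)⁻¹ ≤ ∑ i, (l i - L)⁻¹ :=
    Finset.single_le_sum (f := fun i => (l i - L)⁻¹)
      (fun j _ => (inv_pos.2 (sub_pos.2 (hl j))).le) (Finset.mem_univ i)
  have h2 := (inv_lt_one₀ (sub_pos.2 (hl i))).1 (h1.trans_lt hφ)
  linarith

section Lower

variable {n : ℕ} {A : Matrix (Fin n) (Fin n) ℝ} {L : ℝ}

theorem posDef_sub_add_one (hA : (A - L • (1 : Matrix (Fin n) (Fin n) ℝ)).PosDef)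
    (hφ : lowerPotential L A < 1) :
    (A - (L + 1) • (1 : Matrix (Fin n) (Fin n) ℝ)).PosDef := by
  obtain ⟨E, l, hE, hE', rfl, hl⟩ := exists_diagonalization_of_lowerPotential_lt_one hA hφ
  rw [orthogonal_conj_sub_smul_one hE', posDef_orthogonal_conj_diagonal_iff hE]
  exact fun i => sub_pos.2 (hl i)

theorem lowerPotential_lt_add_one (hn : 0 < n)
    (hA : (A - L • (1 : Matrix (Fin n) (Fin n) ℝ)).PosDef) (hφ : lowerPotential L A < 1) :
    lowerPotential L A < lowerPotential (L + 1) A := by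
  have : Nonempty (Fin n) := ⟨⟨0, hn⟩⟩
  obtain ⟨E, l, hE, hE', rfl, hl⟩ := exists_diagonalization_of_lowerPotential_lt_one hA hφ
  rw [lowerPotential_orthogonal_conj hE hE' hl,
    lowerPotential_orthogonal_conj hE hE' fun i => (lt_add_one L).trans (hl i)]
  refine Finset.sum_lt_sum_of_nonempty Finset.univ_nonempty fun i _ => ?_
  exact inv_strictAnti₀ (by linarith [hl i]) (by linarith)

/-- The rows of `V` resolve the identity, `∑ yⱼ yⱼᵀ = VᵀV = 1`, so quadratic forms sum to traces. -/
theorem sum_dotProduct_mulVec_row {m : ℕ} {V : Matrix (Fin m) (Fin n) ℝ} (hV : Vᵀ * V = 1)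
    (N : Matrix (Fin n) (Fin n) ℝ) : ∑ j, V j ⬝ᵥ (N *ᵥ V j) = N.trace := by
  have h : ∑ j, V j ⬝ᵥ (N *ᵥ V j) = (V * (N * Vᵀ)).trace := rfl
  rw [h, Matrix.trace_mul_comm, Matrix.mul_assoc, hV, Matrix.mul_one]

theorem le_sum_lowerGain (hn : 0 < n) {m : ℕ} {V : Matrix (Fin m) (Fin n) ℝ} (hV : Vᵀ * V = 1)
    (hA : (A - L • (1 : Matrix (Fin n) (Fin n) ℝ)).PosDef) (hφ : lowerPotential L A < 1) :
    1 - lowerPotential L A ≤ ∑ j, lowerGain (V j) 1 A L := by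
  simp only [lowerGain]
  rw [Finset.sum_sub_distrib, ← Finset.sum_div, sum_dotProduct_mulVec_row hV,
    sum_dotProduct_mulVec_row hV]
  obtain ⟨E, l, hE, hE', rfl, hl⟩ := exists_diagonalization_of_lowerPotential_lt_one hA hφ
  have hl' : ∀ i, L < l i := fun i => (lt_add_one L).trans (hl i)
  rw [lowerPotential_orthogonal_conj hE hE' hl'] at hφ
  rw [lowerPotential_orthogonal_conj hE hE' hl, lowerPotential_orthogonal_conj hE hE' hl',
    orthogonal_conj_sub_smul_one hE',
    orthogonal_conj_inv hE hE' fun i => (sub_pos.2 (hl i)).ne', orthogonal_conj_mul hE,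
    diagonal_mul_diagonal, orthogonal_conj_trace hE, orthogonal_conj_trace hE]
  have := lower_averaging hn (a := fun i => l i - L) (fun i => by linarith [hl i]) hφ.le
  simpa only [sub_sub] using this

/-- The lower gain is the exact threshold. With `N = (A - (L+1))⁻¹` and `D` the increase of the
potential caused by moving the barrier, `htv` rearranges to `D ≤ t vᵀN²v / (1 + t vᵀNv)`, and the
right side is the decrease caused by the rank-one update. -/
theorem lowerPotential_update_le (hn : 0 < n)
    (hA : (A - L • (1 : Matrix (Fin n) (Fin n) ℝ)).PosDef) (hφ : lowerPotential L A < 1)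
    {v : Fin n → ℝ} {t : ℝ} (ht : 0 < t) (htv : t⁻¹ ≤ lowerGain v 1 A L) :
    (A + t • vecMulVec v v - (L + 1) • (1 : Matrix (Fin n) (Fin n) ℝ)).PosDef ∧
      lowerPotential (L + 1) (A + t • vecMulVec v v) ≤ lowerPotential L A := by
  have hM := posDef_sub_add_one hA hφ
  have hD := sub_pos.2 (lowerPotential_lt_add_one hn hA hφ)
  have e : A + t • vecMulVec v v - (L + 1) • (1 : Matrix (Fin n) (Fin n) ℝ)
      = (A - (L + 1) • (1 : Matrix (Fin n) (Fin n) ℝ)) + t • vecMulVec v v := by abel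
  have hq : 0 ≤ v ⬝ᵥ ((A - (L + 1) • (1 : Matrix (Fin n) (Fin n) ℝ))⁻¹ *ᵥ v) := by
    simpa using hM.inv.posSemidef.dotProduct_mulVec_nonneg v
  have hpos : 0 < 1 + t * (v ⬝ᵥ ((A - (L + 1) • (1 : Matrix (Fin n) (Fin n) ℝ))⁻¹ *ᵥ v)) := by
    positivity
  constructor
  · rw [e]
    refine hM.add_posSemidef (PosSemidef.smul ?_ ht.le)
    simpa using posSemidef_vecMulVec_self_star v
  · simp only [lowerGain] at htv
    have hu := (Matrix.isUnit_iff_isUnit_det _).1 hM.isUnit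
    rw [lowerPotential, e, trace_inv_add_smul_vecMulVec hu v t hpos.ne', sub_le_comm]
    change lowerPotential (L + 1) A - lowerPotential L A ≤ _
    rw [le_sub_iff_add_le, le_div_iff₀ hD] at htv
    rw [le_div_iff₀ hpos]
    have := mul_le_mul_of_nonneg_left htv ht.le
    rw [← mul_assoc, mul_add, mul_inv_cancel₀ ht.ne'] at this
    linarith

end Lower

/-! ### The upper barrier for diagonal matrices -/

section Upper

variable {m : ℕ} {s : Fin m → ℝ} {T δ : ℝ}

theorem inv_smul_one_sub_diagonal (hs : ∀ i, s i < T) :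
    (T • (1 : Matrix (Fin m) (Fin m) ℝ) - diagonal s)⁻¹ = diagonal fun i => (T - s i)⁻¹ := by
  refine Matrix.inv_eq_right_inv ?_
  rw [smul_one_eq_diagonal, diagonal_sub, diagonal_mul_diagonal, ← diagonal_one]
  congr 1
  funext i
  exact mul_inv_cancel₀ (sub_pos.2 (hs i)).ne'

theorem upperPotential_diagonal (hs : ∀ i, s i < T) :
    upperPotential T (diagonal s) = ∑ i, (T - s i)⁻¹ := by
  rw [upperPotential, inv_smul_one_sub_diagonal hs, trace_diagonal]

theorem upperGain_single_diagonal (hδ : 0 < δ) (hs : ∀ i, s i < T) (j : Fin m) :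
    upperGain (Pi.single j 1) δ (diagonal s) T
      = (T + δ - s j)⁻¹ * (T + δ - s j)⁻¹ / (∑ i, (T - s i)⁻¹ - ∑ i, (T + δ - s i)⁻¹)
        + (T + δ - s j)⁻¹ := by
  have hs' : ∀ i, s i < T + δ := fun i => (hs i).trans (by linarith)
  simp only [upperGain]
  rw [upperPotential_diagonal hs, upperPotential_diagonal hs', inv_smul_one_sub_diagonal hs',
    diagonal_mul_diagonal]
  simp

theorem sum_inv_sub_pos (hm : 0 < m) (hδ : 0 < δ) (hs : ∀ i, s i < T) :
    0 < ∑ i, (T - s i)⁻¹ - ∑ i, (T + δ - s i)⁻¹ := by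
  have : Nonempty (Fin m) := ⟨⟨0, hm⟩⟩
  refine sub_pos.2 (Finset.sum_lt_sum_of_nonempty Finset.univ_nonempty fun i _ => ?_)
  exact inv_strictAnti₀ (sub_pos.2 (hs i)) (by linarith)

theorem sum_upperGain_le (hm : 0 < m) (hδ : 0 < δ) (hs : ∀ i, s i < T) :
    ∑ j, upperGain (Pi.single j 1) δ (diagonal s) T ≤ δ⁻¹ + ∑ i, (T - s i)⁻¹ := by
  simp only [upperGain_single_diagonal hδ hs]
  rw [Finset.sum_add_distrib, ← Finset.sum_div]
  have := upper_averaging hm (b := fun i => T - s i) hδ fun i => sub_pos.2 (hs i)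
  simpa only [sub_add_eq_add_sub] using this

theorem upperGain_single_pos (hm : 0 < m) (hδ : 0 < δ) (hs : ∀ i, s i < T) (j : Fin m) :
    0 < upperGain (Pi.single j 1) δ (diagonal s) T := by
  rw [upperGain_single_diagonal hδ hs]
  have h1 : 0 < T + δ - s j := by linarith [hs j]
  have h2 := sum_inv_sub_pos hm hδ hs
  positivity

/-- Only the term of `j` feels the update. With `b = T + δ - sⱼ`, the gain condition reads `t⁻¹ -
b⁻¹ ≥ b⁻² / D`. It forces `t < b`, and the increase `(b-t)⁻¹ - b⁻¹ = b⁻² / (t⁻¹ - b⁻¹)` is then at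
most `D`, the amount saved by moving the barrier. -/
theorem upper_update_le (hm : 0 < m) (hδ : 0 < δ) (hs : ∀ i, s i < T) {j : Fin m} {t : ℝ}
    (ht : 0 < t) (htu : upperGain (Pi.single j 1) δ (diagonal s) T ≤ t⁻¹) :
    (∀ i, (s + Pi.single j t : Fin m → ℝ) i < T + δ) ∧
      ∑ i, (T + δ - (s + Pi.single j t : Fin m → ℝ) i)⁻¹ ≤ ∑ i, (T - s i)⁻¹ := by
  rw [upperGain_single_diagonal hδ hs] at htu
  have hD := sum_inv_sub_pos hm hδ hs
  set D := ∑ i, (T - s i)⁻¹ - ∑ i, (T + δ - s i)⁻¹ with hDdef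
  have hb : 0 < T + δ - s j := by linarith [hs j]
  set b := T + δ - s j with hbdef
  have h1 : b⁻¹ < t⁻¹ := by
    have : 0 < b⁻¹ * b⁻¹ / D := by positivity
    linarith
  have htb : t < b := (inv_lt_inv₀ hb ht).1 h1
  constructor
  · intro i
    by_cases h : i = j
    · subst h; simp; linarith
    · simp [h]; linarith [hs i]
  · have e : ∑ i, (T + δ - (s + Pi.single j t : Fin m → ℝ) i)⁻¹
        = ∑ i, (T + δ - s i)⁻¹ + ((b - t)⁻¹ - b⁻¹) := by
      rw [← sub_eq_iff_eq_add', ← Finset.sum_sub_distrib, Finset.sum_eq_single j]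
      · simp [hbdef, sub_sub]
      · intro i _ h; simp [h]
      · simp
    rw [e]
    suffices (b - t)⁻¹ - b⁻¹ ≤ D by linarith
    have h2 : b⁻¹ * b⁻¹ / D ≤ t⁻¹ - b⁻¹ := by linarith
    rw [div_le_iff₀ hD] at h2
    have h3 : 0 < t⁻¹ - b⁻¹ := sub_pos.2 h1
    have h4 : (b - t)⁻¹ - b⁻¹ = b⁻¹ * b⁻¹ / (t⁻¹ - b⁻¹) := by
      have : b - t ≠ 0 := (sub_pos.2 htb).ne'
      field_simp
      ring
    rw [h4, div_le_iff₀ h3]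
    linarith

end Upper

end DualSet

/-! ### The barrier invariant along the iterations -/

namespace DualSet

open Matrix

theorem sqrt_div_lt_one {n k : ℕ} (hk : n < k) : √((n : ℝ) / k) < 1 := by
  have hk0 : (0 : ℝ) < k := by exact_mod_cast (Nat.zero_le n).trans_lt hk
  rw [Real.sqrt_lt' one_pos, one_pow, div_lt_one hk0]
  exact_mod_cast hk

theorem sqrt_mul_eq_mul_sqrt_div (n : ℕ) {k : ℕ} (hk : 0 < k) :
    √((n : ℝ) * k) = k * √((n : ℝ) / k) := by
  have hk0 : (0 : ℝ) < k := by exact_mod_cast hk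
  rw [← Real.sqrt_sq hk0.le, ← Real.sqrt_mul (by positivity), Real.sqrt_sq hk0.le]
  congr 1
  field_simp

theorem upperStep_pos {n m k : ℕ} (hk : n < k) : 0 < upperStep n m k :=
  div_pos (by positivity) (sub_pos.2 (sqrt_div_lt_one hk))

/-- The barrier conditions satisfied by the state after `τ` iterations. -/
structure BarrierInv {m n : ℕ} (V : Matrix (Fin m) (Fin n) ℝ) (k τ : ℕ) (st : State m n m) :
    Prop where
  A_eq : st.A = Vᵀ * diagonal st.s * V
  B_eq : st.B = diagonal st.s
  posDef : (st.A - ((τ : ℝ) - √((n : ℝ) * k)) • (1 : Matrix (Fin n) (Fin n) ℝ)).PosDef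
  lower_le : lowerPotential ((τ : ℝ) - √((n : ℝ) * k)) st.A ≤ √((n : ℝ) / k)
  lt : ∀ i, st.s i < upperStep n m k * ((τ : ℝ) + √((m : ℝ) * k))
  upper_le : ∑ i, (upperStep n m k * ((τ : ℝ) + √((m : ℝ) * k)) - st.s i)⁻¹
    ≤ √((m : ℝ) / k) / upperStep n m k
  card_le : (Finset.univ.filter fun i => st.s i ≠ 0).card ≤ τ

section

variable {m n k : ℕ} {V : Matrix (Fin m) (Fin n) ℝ}

/-- The initial barriers `-√(nk)` and `δ√(mk)` make both potential bounds equalities. -/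
theorem BarrierInv.zero (hn : 0 < n) (hk : n < k) (hm : k ≤ m) :
    BarrierInv V k 0 { s := 0, A := 0, B := 0 } := by
  have hk0 : 0 < k := hn.trans hk
  have hδ := upperStep_pos (m := m) hk
  have hn' : (0 : ℝ) < n := by exact_mod_cast hn
  have hk' : (0 : ℝ) < k := by exact_mod_cast hk0
  have hm' : (0 : ℝ) < m := by exact_mod_cast hk0.trans_le hm
  -- Used with `a = n` and with `a = m`, where the potentials are `n/√(nk)` and `m/(δ√(mk))`.
  have key : ∀ a : ℝ, 0 < a → a * (√(a * k))⁻¹ = √(a / k) := by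
    intro a ha
    rw [Real.sqrt_mul ha.le, Real.sqrt_div ha.le, mul_inv, ← mul_assoc, div_eq_mul_inv]
    congr 1
    rw [← div_eq_mul_inv, Real.div_sqrt]
  have e : ((0 : Matrix (Fin n) (Fin n) ℝ)
      - (((0 : ℕ) : ℝ) - √((n : ℝ) * k)) • (1 : Matrix (Fin n) (Fin n) ℝ))
      = diagonal fun _ => √((n : ℝ) * k) := by
    rw [smul_one_eq_diagonal, ← diagonal_zero, diagonal_sub]; simp
  refine ⟨by simp, by simp, ?_, ?_, ?_, ?_, by simp⟩
  · show ((0 : Matrix (Fin n) (Fin n) ℝ)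
      - (((0 : ℕ) : ℝ) - √((n : ℝ) * k)) • (1 : Matrix (Fin n) (Fin n) ℝ)).PosDef
    rw [e, posDef_diagonal_iff]
    intro _; positivity
  · have e' : (diagonal fun _ : Fin n => √((n : ℝ) * k))⁻¹
        = diagonal fun _ => (√((n : ℝ) * k))⁻¹ := by
      refine Matrix.inv_eq_right_inv ?_
      rw [diagonal_mul_diagonal, mul_inv_cancel₀ (by positivity), diagonal_one]
    show lowerPotential _ 0 ≤ _
    rw [lowerPotential, e, e', trace_diagonal]
    simpa using (key n hn').le
  · intro i
    simp only [Pi.zero_apply, Nat.cast_zero, zero_add]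
    positivity
  · simp only [Pi.zero_apply, Nat.cast_zero, zero_add, sub_zero, Finset.sum_const,
      Finset.card_univ, Fintype.card_fin, nsmul_eq_mul, mul_inv]
    rw [mul_left_comm, key m hm']
    exact (div_eq_inv_mul _ _).ge

variable {τ : ℕ} {st st' : State m n m}

theorem BarrierInv.lowerPotential_lt_one (h : BarrierInv V k τ st) (hk : n < k) :
    lowerPotential ((τ : ℝ) - √((n : ℝ) * k)) st.A < 1 :=
  h.lower_le.trans_lt (sqrt_div_lt_one hk)

/-- This fixes the value of `δ`: the bound `δ⁻¹(1 + √(m/k))` on the sum of the upper gains equals `1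
- √(n/k)`, which bounds the sum of the lower gains from below. -/
theorem BarrierInv.exists_index (h : BarrierInv V k τ st) (hn : 0 < n) (hk : n < k) (hm : k ≤ m)
    (hV : Vᵀ * V = 1) :
    ∃ j, upperGain (Pi.single j 1) (upperStep n m k) st.B
        (upperStep n m k * ((τ : ℝ) + √((m : ℝ) * k)))
      ≤ lowerGain (V j) 1 st.A ((τ : ℝ) - √((n : ℝ) * k)) := by
  have hm0 : 0 < m := (hn.trans hk).trans_le hm
  have : Nonempty (Fin m) := ⟨⟨0, hm0⟩⟩
  have hδ := upperStep_pos (m := m) hk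
  have h1 := le_sum_lowerGain hn hV h.posDef (h.lowerPotential_lt_one hk)
  have h2 := sum_upperGain_le hm0 hδ h.lt
  rw [← h.B_eq] at h2
  have h3 : (upperStep n m k)⁻¹ + √((m : ℝ) / k) / upperStep n m k = 1 - √((n : ℝ) / k) := by
    have a : 0 < 1 - √((n : ℝ) / k) := sub_pos.2 (sqrt_div_lt_one hk)
    have b : (0 : ℝ) < 1 + √((m : ℝ) / k) := by positivity
    rw [upperStep]
    field_simp
  have h4 := h.lower_le
  have h5 := h.upper_le
  obtain ⟨j, -, hj⟩ := Finset.exists_le_of_sum_le (s := Finset.univ) Finset.univ_nonempty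
    (h2.trans ((by linarith : _ ≤ _).trans h1))
  exact ⟨j, hj⟩

theorem transpose_mul_diagonal_add_single_mul (V : Matrix (Fin m) (Fin n) ℝ) (s : Fin m → ℝ)
    (j : Fin m) (t : ℝ) :
    Vᵀ * diagonal (s + Pi.single j t) * V = Vᵀ * diagonal s * V + t • vecMulVec (V j) (V j) := by
  have e : Vᵀ * diagonal (Pi.single j t) * V = t • vecMulVec (V j) (V j) := by
    ext a b
    rw [Matrix.mul_apply, Finset.sum_eq_single j]
    · simp [mul_diagonal, vecMulVec_apply]; ring
    · intro i _ hi; simp [mul_diagonal, hi]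
    · simp
  rw [← e, ← Matrix.add_mul, ← Matrix.mul_add, diagonal_add]
  rfl

theorem BarrierInv.step (h : BarrierInv V k τ st) (hn : 0 < n) (hk : n < k) (hm : k ≤ m)
    (hst : IsStep (fun i => V i) (fun i : Fin m => (Pi.single i 1 : Fin m → ℝ)) k τ st st') :
    BarrierInv V k (τ + 1) st' := by
  have hm0 : 0 < m := (hn.trans hk).trans_le hm
  have hδ := upperStep_pos (m := m) hk
  obtain ⟨j, hj, rfl⟩ := hst
  have hup := upperGain_single_pos hm0 hδ h.lt j
  rw [← h.B_eq] at hup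
  set lo := lowerGain (V j) 1 st.A ((τ : ℝ) - √((n : ℝ) * k))
  set up := upperGain (Pi.single j 1) (upperStep n m k) st.B
    (upperStep n m k * ((τ : ℝ) + √((m : ℝ) * k))) with hupdef
  set t := ((up + lo) / 2)⁻¹ with htdef
  have hti : t⁻¹ = (up + lo) / 2 := inv_inv _
  -- The upper gain is positive, hence so is the mean. As `t⁻¹` is the midpoint of `up` and `lo`, it
  -- satisfies the conditions of both barrier updates.
  have ht : 0 < t := inv_pos.2 (by linarith)
  have hlow := lowerPotential_update_le hn h.posDef (h.lowerPotential_lt_one hk) ht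
    (v := V j) (by rw [hti]; show _ ≤ lo; linarith)
  have hupp := upper_update_le hm0 hδ h.lt ht (j := j)
    (by rw [hti, ← h.B_eq]; show up ≤ _; linarith)
  have eL : ((τ + 1 : ℕ) : ℝ) - √((n : ℝ) * k) = (τ : ℝ) - √((n : ℝ) * k) + 1 := by
    push_cast; ring
  have eT : upperStep n m k * (((τ + 1 : ℕ) : ℝ) + √((m : ℝ) * k))
      = upperStep n m k * ((τ : ℝ) + √((m : ℝ) * k)) + upperStep n m k := by
    push_cast; ring
  refine ⟨?_, ?_, ?_, ?_, ?_, ?_, ?_⟩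
  · show st.A + t • vecMulVec (V j) (V j) = Vᵀ * diagonal (st.s + Pi.single j t) * V
    rw [transpose_mul_diagonal_add_single_mul, ← h.A_eq]
  · show st.B + t • vecMulVec (Pi.single j 1) (Pi.single j 1) = diagonal (st.s + Pi.single j t)
    have e : diagonal (st.s + Pi.single j t) = diagonal st.s + diagonal (Pi.single j t) := by
      rw [diagonal_add]; rfl
    rw [e, h.B_eq]
    congr 1
    ext a b
    rcases eq_or_ne a j with rfl | ha <;> rcases eq_or_ne b a with rfl | hb <;>
      simp_all [vecMulVec_apply, Pi.single_apply, eq_comm]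
  · rw [eL]; exact hlow.1
  · rw [eL]; exact hlow.2.trans h.lower_le
  · rw [eT]; exact hupp.1
  · rw [eT]; exact hupp.2.trans h.upper_le
  · calc _ ≤ (insert j (Finset.univ.filter fun i => st.s i ≠ 0)).card := by
          refine Finset.card_le_card fun i hi => ?_
          rcases eq_or_ne i j with rfl | hij
          · simp
          · simpa [hij] using hi
      _ ≤ _ := (Finset.card_insert_le _ _).trans (Nat.succ_le_succ h.card_le)

/-- Both sides are compared with `zᵀ A z = ∑ sᵢ (Vz)ᵢ²`: positive definiteness bounds it below, and
the upper barrier bounds each weight on `S`. -/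
theorem BarrierInv.norm_sq_le (h : BarrierInv V k τ st) (hV : Vᵀ * V = 1) {S : Finset (Fin m)}
    (hS : ∀ i, i ∉ S → st.s i = 0) (z : Fin n → ℝ) :
    ((τ : ℝ) - √((n : ℝ) * k)) * ((V *ᵥ z) ⬝ᵥ (V *ᵥ z))
      ≤ upperStep n m k * ((τ : ℝ) + √((m : ℝ) * k)) * ∑ i ∈ S, (V *ᵥ z) i ^ 2 := by
  have h1 := h.posDef.posSemidef.dotProduct_mulVec_nonneg z
  rw [sub_mulVec, dotProduct_sub, star_trivial, smul_mulVec, one_mulVec, dotProduct_smul,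
    smul_eq_mul, h.A_eq, ← mulVec_mulVec, ← mulVec_mulVec, dotProduct_mulVec,
    vecMul_transpose] at h1
  have h2 : (V *ᵥ z) ⬝ᵥ (V *ᵥ z) = z ⬝ᵥ z := by
    rw [dotProduct_mulVec, ← mulVec_transpose, mulVec_mulVec, hV, one_mulVec]
  rw [h2]
  refine (sub_nonneg.1 h1).trans ?_
  have e : (V *ᵥ z) ⬝ᵥ (diagonal st.s *ᵥ (V *ᵥ z)) = ∑ i ∈ S, st.s i * (V *ᵥ z) i ^ 2 := by
    rw [Finset.sum_subset (Finset.subset_univ S) fun i _ hi => by rw [hS i hi, zero_mul]]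
    refine Finset.sum_congr rfl fun i _ => ?_
    rw [mulVec_diagonal]; ring
  rw [e, Finset.mul_sum]
  exact Finset.sum_le_sum fun i _ => mul_le_mul_of_nonneg_right (h.lt i).le (sq_nonneg _)

end

end DualSet

/-! ### Pseudo-inverses of matrices of full row rank -/

section FullRowRank

open Matrix

variable {n : ℕ} {ι κ : Type*} [Fintype ι] [Fintype κ]

theorem posDef_mul_transpose_of_rank_eq {X : Matrix (Fin n) ι ℝ} (hX : X.rank = n) :
    (X * Xᵀ).PosDef := by
  have h : LinearIndependent ℝ X.row := by
    rw [linearIndependent_iff_card_eq_finrank_span, Fintype.card_fin, Set.finrank,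
      ← Matrix.rank_eq_finrank_span_row, hX]
  have := PosDef.mul_conjTranspose_self X (Matrix.vecMul_injective_iff.2 h)
  simpa using this

theorem rank_eq_of_posDef_mul_transpose {X : Matrix (Fin n) ι ℝ} (hX : (X * Xᵀ).PosDef) :
    X.rank = n := by
  rw [← Matrix.rank_self_mul_transpose, Matrix.rank_of_isUnit _ hX.isUnit, Fintype.card_fin]

theorem mul_pinv_of_posDef {X : Matrix (Fin n) ι ℝ} (hX : (X * Xᵀ).PosDef) : X * pinv X = 1 := by
  have h1 := (pinv_spec X).mul_mul_self
  have h2 : (X * pinv X) * (X * Xᵀ) = 1 * (X * Xᵀ) := by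
    rw [← Matrix.mul_assoc, h1, Matrix.one_mul]
  exact hX.isUnit.mul_left_injective h2

theorem dotProduct_sq_le (x y : ι → ℝ) : (x ⬝ᵥ y) ^ 2 ≤ (x ⬝ᵥ x) * (y ⬝ᵥ y) := by
  have := Finset.sum_mul_sq_le_sq_mul_sq Finset.univ x y
  simpa only [dotProduct, sq] using this

theorem dotProduct_mul_transpose_mulVec (X : Matrix (Fin n) ι ℝ) (z : Fin n → ℝ) :
    z ⬝ᵥ ((X * Xᵀ) *ᵥ z) = (Xᵀ *ᵥ z) ⬝ᵥ (Xᵀ *ᵥ z) := by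
  rw [← mulVec_mulVec, dotProduct_mulVec, mulVec_transpose]

/-- If `‖Xᵀ z‖² ≤ c ‖Yᵀ z‖²` for all `z`, and `X` has full row rank, then so has `Y`. -/
theorem posDef_mul_transpose_of_norm_sq_le {X : Matrix (Fin n) ι ℝ} {Y : Matrix (Fin n) κ ℝ}
    (hX : (X * Xᵀ).PosDef) {c : ℝ}
    (hXY : ∀ z, (Xᵀ *ᵥ z) ⬝ᵥ (Xᵀ *ᵥ z) ≤ c * ((Yᵀ *ᵥ z) ⬝ᵥ (Yᵀ *ᵥ z))) :
    (Y * Yᵀ).PosDef := by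
  refine PosDef.of_dotProduct_mulVec_pos ?_ fun z hz => ?_
  · simpa using Matrix.isHermitian_mul_conjTranspose_self Y
  · rw [star_trivial, dotProduct_mul_transpose_mulVec]
    have h1 := hX.dotProduct_mulVec_pos hz
    rw [star_trivial, dotProduct_mul_transpose_mulVec] at h1
    have h3 : 0 ≤ (Yᵀ *ᵥ z) ⬝ᵥ (Yᵀ *ᵥ z) := Finset.sum_nonneg fun i _ => mul_self_nonneg _
    refine lt_of_le_of_ne h3 fun h0 => ?_
    have h2 := hXY z
    rw [← h0, mul_zero] at h2
    linarith

/-- The vector `p = Y†w` lies in the range of `Yᵀ`, say `p = Yᵀz`. Since `Yp = w = Xq`, one gets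
`‖p‖² = ⟨w, z⟩ = ⟨q, Xᵀz⟩`. Cauchy–Schwarz and the hypothesis give `‖p‖⁴ ≤ ‖q‖² · c‖p‖²`. -/
theorem pinv_mulVec_norm_sq_le {X : Matrix (Fin n) ι ℝ} {Y : Matrix (Fin n) κ ℝ}
    (hX : (X * Xᵀ).PosDef) {c : ℝ}
    (hXY : ∀ z, (Xᵀ *ᵥ z) ⬝ᵥ (Xᵀ *ᵥ z) ≤ c * ((Yᵀ *ᵥ z) ⬝ᵥ (Yᵀ *ᵥ z))) (w : Fin n → ℝ) :
    (pinv Y *ᵥ w) ⬝ᵥ (pinv Y *ᵥ w) ≤ c * ((pinv X *ᵥ w) ⬝ᵥ (pinv X *ᵥ w)) := by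
  have hY := posDef_mul_transpose_of_norm_sq_le hX hXY
  set p := pinv Y *ᵥ w with hp
  set q := pinv X *ᵥ w with hq
  set z := (pinv Y)ᵀ *ᵥ p with hz
  have hYp : Y *ᵥ p = w := by rw [hp, mulVec_mulVec, mul_pinv_of_posDef hY, one_mulVec]
  have hXq : X *ᵥ q = w := by rw [hq, mulVec_mulVec, mul_pinv_of_posDef hX, one_mulVec]
  have hpz : p = Yᵀ *ᵥ z := by
    rw [hz, mulVec_mulVec, ← transpose_mul, (pinv_spec Y).symm_right, hp, mulVec_mulVec,
      (pinv_spec Y).mul_mul_inv]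
  have h1 : p ⬝ᵥ p = q ⬝ᵥ (Xᵀ *ᵥ z) := by
    calc p ⬝ᵥ p = p ⬝ᵥ (Yᵀ *ᵥ z) := congrArg _ hpz
      _ = (Y *ᵥ p) ⬝ᵥ z := by rw [dotProduct_mulVec, vecMul_transpose]
      _ = (X *ᵥ q) ⬝ᵥ z := congrArg (· ⬝ᵥ z) (hYp.trans hXq.symm)
      _ = _ := by rw [dotProduct_mulVec q, vecMul_transpose]
  have hq0 : 0 ≤ q ⬝ᵥ q := Finset.sum_nonneg fun i _ => mul_self_nonneg _
  have hp0 : 0 ≤ p ⬝ᵥ p := Finset.sum_nonneg fun i _ => mul_self_nonneg _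
  have h2 : (p ⬝ᵥ p) ^ 2 ≤ (q ⬝ᵥ q) * (c * (p ⬝ᵥ p)) := by
    rw [h1]
    refine (dotProduct_sq_le _ _).trans (mul_le_mul_of_nonneg_left ?_ hq0)
    rw [← h1]
    have := hXY z
    rwa [← hpz] at this
  -- The case `p = 0` is separate because nothing is assumed about the sign of `c`; there `w = Yp =
  -- 0` and so `q = 0`.
  rcases hp0.eq_or_lt with h0 | h0
  · have hw : w = 0 := by
      rw [← hYp, dotProduct_self_eq_zero.1 h0.symm, mulVec_zero]
    have : q = 0 := by rw [hq, hw, mulVec_zero]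
    rw [← h0, this]; simp
  · nlinarith

theorem norm_toEuclideanLin_sq [DecidableEq ι] (A : Matrix κ ι ℝ) (w : EuclideanSpace ℝ ι) :
    ‖(Matrix.toEuclideanLin A).toContinuousLinearMap w‖ ^ 2
      = (A *ᵥ w.ofLp) ⬝ᵥ (A *ᵥ w.ofLp) := by
  rw [EuclideanSpace.norm_sq_eq]
  simp [dotProduct, sq, Matrix.toLpLin_apply]

theorem spectralNorm₂_eq [DecidableEq ι] (A : Matrix κ ι ℝ) :
    spectralNorm₂ A = ‖(Matrix.toEuclideanLin A).toContinuousLinearMap‖ := by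
  have h : (inferInstance : DecidableEq ι) = Classical.decEq ι := Subsingleton.elim _ _
  subst h
  rfl

theorem spectralNorm₂_sq_le {P : Matrix κ (Fin n) ℝ} {Q : Matrix ι (Fin n) ℝ} {c : ℝ}
    (hc : 0 ≤ c) (h : ∀ w, (P *ᵥ w) ⬝ᵥ (P *ᵥ w) ≤ c * ((Q *ᵥ w) ⬝ᵥ (Q *ᵥ w))) :
    spectralNorm₂ P ^ 2 ≤ c * spectralNorm₂ Q ^ 2 := by
  have hb : spectralNorm₂ P ≤ √c * spectralNorm₂ Q := by
    rw [spectralNorm₂_eq, spectralNorm₂_eq]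
    refine ContinuousLinearMap.opNorm_le_bound _ (mul_nonneg (Real.sqrt_nonneg _)
      (norm_nonneg _)) fun w => ?_
    have h1 := h w.ofLp
    rw [← norm_toEuclideanLin_sq, ← norm_toEuclideanLin_sq] at h1
    have h2 := Real.le_sqrt_of_sq_le h1
    rw [Real.sqrt_mul hc, Real.sqrt_sq (norm_nonneg _)] at h2
    rw [mul_assoc]
    exact h2.trans (mul_le_mul_of_nonneg_left (ContinuousLinearMap.le_opNorm _ w)
      (Real.sqrt_nonneg _))
  have hP : 0 ≤ spectralNorm₂ P := norm_nonneg _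
  calc _ ≤ (√c * spectralNorm₂ Q) ^ 2 := pow_le_pow_left₀ hP hb 2
    _ = _ := by rw [mul_pow, Real.sq_sqrt hc]

theorem frobeniusNorm_sq_eq (P : Matrix κ (Fin n) ℝ) :
    frobeniusNorm P ^ 2 = ∑ j, (P *ᵥ Pi.single j 1) ⬝ᵥ (P *ᵥ Pi.single j 1) := by
  have h : 0 ≤ ∑ i, ∑ j, P i j ^ 2 :=
    Finset.sum_nonneg fun i _ => Finset.sum_nonneg fun j _ => sq_nonneg _
  rw [frobeniusNorm, Real.sq_sqrt h, Finset.sum_comm]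
  simp [dotProduct, sq]

/-- The pointwise bound is tested on the standard basis, that is, on columns. -/
theorem frobeniusNorm_sq_le {P : Matrix κ (Fin n) ℝ} {Q : Matrix ι (Fin n) ℝ} {c : ℝ}
    (h : ∀ w, (P *ᵥ w) ⬝ᵥ (P *ᵥ w) ≤ c * ((Q *ᵥ w) ⬝ᵥ (Q *ᵥ w))) :
    frobeniusNorm P ^ 2 ≤ c * frobeniusNorm Q ^ 2 := by
  rw [frobeniusNorm_sq_eq, frobeniusNorm_sq_eq, Finset.mul_sum]
  exact Finset.sum_le_sum fun j _ => h _

end FullRowRank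

/-! ### Singular value decompositions of matrices of full row rank -/

section SVD

open Matrix

variable {n m : ℕ} {X : Matrix (Fin n) (Fin m) ℝ}

/-- The eigenvectors of `XXᵀ`, all of whose eigenvalues are positive, serve as `U`; then `σ`
consists of the square roots and `V = Xᵀ U diag(σ)⁻¹`. -/
theorem exists_isRightSingularMatrix (hX : X.rank = n) :
    ∃ V : Matrix (Fin m) (Fin n) ℝ, IsRightSingularMatrix X V := by
  have hG := posDef_mul_transpose_of_rank_eq hX
  obtain ⟨E, l, hE, hE', hEl⟩ := exists_orthogonal_diagonalization hG.1
  have hl : ∀ i, 0 < l i := by rwa [hEl, posDef_orthogonal_conj_diagonal_iff hE] at hG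
  -- Sorting the negatives puts the eigenvalues in decreasing order, as `IsThinSVD` demands.
  set ρ := Tuple.sort fun i => -l i with hρ
  have hρm : Antitone fun i => l (ρ i) := fun i j hij =>
    neg_le_neg_iff.1 (Tuple.monotone_sort (fun i => -l i) hij)
  set U : Matrix (Fin n) (Fin n) ℝ := E.submatrix id ρ with hU
  set σ : Fin n → ℝ := fun i => √(l (ρ i)) with hσ
  have hσ0 : ∀ i, 0 < σ i := fun i => Real.sqrt_pos.2 (hl _)
  have hUU : Uᵀ * U = 1 := by
    rw [hU, transpose_submatrix, submatrix_mul _ _ ρ id ρ Function.bijective_id |>.symm, hE,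
      submatrix_one _ ρ.injective]
  have hUU' : U * Uᵀ = 1 := mul_eq_one_comm.1 hUU
  have hUl : Uᵀ * (X * Xᵀ) * U = diagonal fun i => l (ρ i) := by
    have h1 : Eᵀ * (X * Xᵀ) * E = diagonal l := by
      rw [hEl]
      calc _ = (Eᵀ * E) * diagonal l * (Eᵀ * E) := by simp only [Matrix.mul_assoc]
        _ = _ := by rw [hE, Matrix.one_mul, Matrix.mul_one]
    have h2 : Uᵀ * (X * Xᵀ) * U = (Eᵀ * (X * Xᵀ) * E).submatrix ρ ρ := by
      ext a b
      simp [hU, Matrix.mul_apply]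
    rw [h2, h1, submatrix_diagonal _ _ ρ.injective]
    rfl
  refine ⟨Xᵀ * U * diagonal fun i => (σ i)⁻¹, U, σ, hUU, ?_, ?_, hσ0, ?_⟩
  · calc _ = diagonal (fun i => (σ i)⁻¹) * (Uᵀ * (X * Xᵀ) * U) * diagonal fun i => (σ i)⁻¹ := by
          simp only [transpose_mul, diagonal_transpose, transpose_transpose, Matrix.mul_assoc]
      _ = 1 := by
          rw [hUl, diagonal_mul_diagonal, diagonal_mul_diagonal, ← diagonal_one]
          congr 1
          funext i
          have h1 : σ i * σ i = l (ρ i) := Real.mul_self_sqrt (hl _).le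
          have := (hσ0 i).ne'
          rw [← h1]
          field_simp
  · exact fun i j hij => Real.sqrt_le_sqrt (hρm hij)
  · have : diagonal σ * diagonal (fun i => (σ i)⁻¹) = 1 := by
      rw [diagonal_mul_diagonal, ← diagonal_one]
      congr 1
      funext i
      exact mul_inv_cancel₀ (hσ0 i).ne'
    calc X = (U * Uᵀ) * X := by rw [hUU', Matrix.one_mul]
      _ = U * (diagonal σ * diagonal fun i => (σ i)⁻¹) * Uᵀ * X := by
          rw [this, Matrix.mul_one]
      _ = _ := by
          simp only [transpose_mul, diagonal_transpose, transpose_transpose, Matrix.mul_assoc]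

/-- These are the only properties of the decomposition that the later arguments use. -/
theorem IsRightSingularMatrix.exists_factorization {V : Matrix (Fin m) (Fin n) ℝ}
    (hV : IsRightSingularMatrix X V) :
    Vᵀ * V = 1 ∧ ∃ R : Matrix (Fin n) (Fin n) ℝ, IsUnit R ∧ X = R * Vᵀ := by
  obtain ⟨U, σ, h⟩ := hV
  refine ⟨h.right_orthonormal, U * diagonal σ, ?_, h.eq⟩
  refine IsUnit.mul (IsUnit.of_mul_eq_one_right _ h.left_orthonormal) ?_
  rw [Matrix.isUnit_diagonal, Pi.isUnit_iff]
  exact fun i => (h.pos i).ne'.isUnit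

end SVD

/-! ### Guarantees of the greedy selection -/

namespace DualSet

open Matrix

/-- `st` is reachable from the zero state by `τ` iterations on the rows of `V` and the standard
basis. -/
def Reachable {m n : ℕ} (V : Matrix (Fin m) (Fin n) ℝ) (k τ : ℕ) (st : State m n m) : Prop :=
  ∃ f : ℕ → State m n m, f 0 = { s := 0, A := 0, B := 0 } ∧
    (∀ i < τ, IsStep (fun i => V i) (fun i : Fin m => (Pi.single i 1 : Fin m → ℝ)) k i
      (f i) (f (i + 1))) ∧ f τ = st

section

variable {m n k τ : ℕ} {V : Matrix (Fin m) (Fin n) ℝ} {st st' : State m n m}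

theorem Reachable.zero : Reachable V k 0 { s := 0, A := 0, B := 0 } :=
  ⟨fun _ => { s := 0, A := 0, B := 0 }, rfl, fun i hi => absurd hi (Nat.not_lt_zero i), rfl⟩

theorem Reachable.succ (h : Reachable V k τ st)
    (hst : IsStep (fun i => V i) (fun i : Fin m => (Pi.single i 1 : Fin m → ℝ)) k τ st st') :
    Reachable V k (τ + 1) st' := by
  obtain ⟨f, h0, hf, rfl⟩ := h
  refine ⟨Function.update f (τ + 1) st', ?_, fun i hi => ?_, by simp⟩
  · rw [Function.update_of_ne (by omega), h0]
  · rw [Function.update_of_ne (by omega : i ≠ τ + 1)]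
    rcases (Nat.lt_succ_iff.1 hi).eq_or_lt with rfl | h
    · rwa [Function.update_self]
    · rw [Function.update_of_ne (by omega)]
      exact hf i h

theorem Reachable.barrierInv (h : Reachable V k τ st) (hn : 0 < n) (hk : n < k) (hm : k ≤ m) :
    BarrierInv V k τ st := by
  obtain ⟨f, h0, hf, rfl⟩ := h
  have : ∀ i ≤ τ, BarrierInv V k i (f i) := by
    intro i
    induction i with
    | zero => intro _; rw [h0]; exact BarrierInv.zero hn hk hm
    | succ i ih => exact fun hi => (ih (by omega)).step hn hk hm (hf i hi)
  exact this τ le_rfl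

/-- The final rescaling is by a nonzero factor, so it does not affect the support and the program
may omit it. -/
theorem isGreedySelection_iff (hk : n < k) {S : Finset (Fin m)} :
    IsGreedySelection V k S ↔ ∃ st, Reachable V k k st ∧ ∀ i, i ∈ S ↔ st.s i ≠ 0 := by
  have hk0 : (0 : ℝ) < k := by exact_mod_cast (Nat.zero_le n).trans_lt hk
  have hc : (1 - √((n : ℝ) / k)) / k ≠ 0 :=
    (div_pos (sub_pos.2 (sqrt_div_lt_one hk)) hk0).ne'
  constructor
  · rintro ⟨s, ⟨f, h0, hf, rfl⟩, hS⟩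
    exact ⟨f k, ⟨f, h0, hf, rfl⟩, fun i => by
      rw [hS, Pi.smul_apply, smul_ne_zero_iff]; exact and_iff_right hc⟩
  · rintro ⟨st, ⟨f, h0, hf, rfl⟩, hS⟩
    exact ⟨_, ⟨f, h0, hf, rfl⟩, fun i => by
      rw [hS, Pi.smul_apply, smul_ne_zero_iff]; exact (and_iff_right hc).symm⟩

end

end DualSet

section

open Matrix DualSet

variable {n m k : ℕ} {X : Matrix (Fin n) (Fin m) ℝ} {V : Matrix (Fin m) (Fin n) ℝ}
  {S : Finset (Fin m)}

theorem IsGreedySelection.card_le (hn : 0 < n) (hk : n < k) (hm : k ≤ m)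
    (hS : IsGreedySelection V k S) : S.card ≤ k := by
  obtain ⟨st, hst, hSs⟩ := (isGreedySelection_iff hk).1 hS
  refine le_trans (Finset.card_le_card fun i hi => ?_) (hst.barrierInv hn hk hm).card_le
  simpa using (hSs i).1 hi

theorem IsGreedySelection.norm_sq_le (hn : 0 < n) (hk : n < k) (hm : k ≤ m)
    (hV : IsRightSingularMatrix X V) (hS : IsGreedySelection V k S) (z : Fin n → ℝ) :
    (Xᵀ *ᵥ z) ⬝ᵥ (Xᵀ *ᵥ z) ≤ (1 + √((m : ℝ) / k)) ^ 2 * ((1 - √((n : ℝ) / k)) ^ 2)⁻¹ *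
      (((colSubmatrix X S)ᵀ *ᵥ z) ⬝ᵥ ((colSubmatrix X S)ᵀ *ᵥ z)) := by
  obtain ⟨st, hst, hSs⟩ := (isGreedySelection_iff hk).1 hS
  obtain ⟨hVV, R, -, rfl⟩ := hV.exists_factorization
  have hk0 : 0 < k := hn.trans hk
  have hk' : (0 : ℝ) < k := by exact_mod_cast hk0
  -- The invariant is applied at `Rᵀz`, because `Xᵀz = V(Rᵀz)`.
  have h := (hst.barrierInv hn hk hm).norm_sq_le hVV
    (fun i hi => not_not.1 (mt (hSs i).2 hi)) (Rᵀ *ᵥ z)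
  have e : ((colSubmatrix (R * Vᵀ) S)ᵀ *ᵥ z) ⬝ᵥ ((colSubmatrix (R * Vᵀ) S)ᵀ *ᵥ z)
      = ∑ i ∈ S, (V *ᵥ (Rᵀ *ᵥ z)) i ^ 2 := by
    rw [← Finset.sum_coe_sort S]
    refine Finset.sum_congr rfl fun i _ => ?_
    have : ((colSubmatrix (R * Vᵀ) S)ᵀ *ᵥ z) i = (V *ᵥ (Rᵀ *ᵥ z)) i := by
      rw [mulVec_mulVec, ← Matrix.transpose_transpose V, ← transpose_mul]
      rfl
    rw [this, sq]
  rw [e, transpose_mul, transpose_transpose, ← mulVec_mulVec]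
  set Z := (V *ᵥ (Rᵀ *ᵥ z)) ⬝ᵥ (V *ᵥ (Rᵀ *ᵥ z))
  set W := ∑ i ∈ S, (V *ᵥ (Rᵀ *ᵥ z)) i ^ 2
  have ha : 0 < 1 - √((n : ℝ) / k) := sub_pos.2 (sqrt_div_lt_one hk)
  rw [sqrt_mul_eq_mul_sqrt_div n hk0, sqrt_mul_eq_mul_sqrt_div m hk0, upperStep] at h
  set a := √((n : ℝ) / k)
  set b := √((m : ℝ) / k)
  have h1 : (1 - a) * Z ≤ (1 + b) / (1 - a) * (1 + b) * W := by
    refine le_of_mul_le_mul_left ?_ hk'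
    calc _ = (k - k * a) * Z := by ring
      _ ≤ _ := h
      _ = _ := by ring
  refine le_of_mul_le_mul_left (h1.trans_eq ?_) ha
  field_simp

theorem IsGreedySelection.guarantee (hn : 0 < n) (hk : n < k) (hm : k ≤ m) (hX : X.rank = n)
    (hV : IsRightSingularMatrix X V) (hS : IsGreedySelection V k S) :
    S.card ≤ k ∧
    (colSubmatrix X S).rank = n ∧
    spectralNorm₂ (pinv (colSubmatrix X S)) ^ 2 ≤
      (1 + √((m : ℝ) / k)) ^ 2 * ((1 - √((n : ℝ) / k)) ^ 2)⁻¹ * spectralNorm₂ (pinv X) ^ 2 ∧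
    frobeniusNorm (pinv (colSubmatrix X S)) ^ 2 ≤
      (1 + √((m : ℝ) / k)) ^ 2 * ((1 - √((n : ℝ) / k)) ^ 2)⁻¹ * frobeniusNorm (pinv X) ^ 2 := by
  have hG := posDef_mul_transpose_of_rank_eq hX
  have h := hS.norm_sq_le hn hk hm hV
  have hp := pinv_mulVec_norm_sq_le hG h
  exact ⟨hS.card_le hn hk hm,
    rank_eq_of_posDef_mul_transpose (posDef_mul_transpose_of_norm_sq_le hG h),
    spectralNorm₂_sq_le (by positivity) hp, frobeniusNorm_sq_le hp⟩

end

/-! ### Gains without singular vectors -/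

namespace DualSet

open Matrix

variable {n m : ℕ}

/-- `X diag(s - c) Xᵀ`. -/
def shiftedGram (X : Matrix (Fin n) (Fin m) ℝ) (s : Fin m → ℝ) (c : ℝ) :
    Matrix (Fin n) (Fin n) ℝ :=
  X * diagonal (fun i => s i - c) * Xᵀ

/-- The matrix of the quadratic form that gives the lower gains in terms of the columns of `X`. -/
noncomputable def gainMatrix (X : Matrix (Fin n) (Fin m) ℝ) (s : Fin m → ℝ) (L : ℝ) :
    Matrix (Fin n) (Fin n) ℝ :=
  let N := (shiftedGram X s (L + 1))⁻¹
  (((N - (shiftedGram X s L)⁻¹) * (X * Xᵀ)).trace)⁻¹ • (N * ((X * Xᵀ) * N)) - N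

/-- Writing the identity as `VᵀV` moves the shift `c` into the diagonal weights. -/
theorem shiftedGram_mul_transpose {V : Matrix (Fin m) (Fin n) ℝ} (hV : Vᵀ * V = 1)
    (R : Matrix (Fin n) (Fin n) ℝ) (s : Fin m → ℝ) (c : ℝ) :
    shiftedGram (R * Vᵀ) s c
      = R * (Vᵀ * diagonal s * V - c • (1 : Matrix (Fin n) (Fin n) ℝ)) * Rᵀ := by
  have h : (diagonal fun i => s i - c) = diagonal s - c • (1 : Matrix (Fin m) (Fin m) ℝ) := by
    rw [smul_one_eq_diagonal, diagonal_sub]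
  rw [shiftedGram, h, ← hV, transpose_mul, transpose_transpose]
  simp only [Matrix.mul_sub, Matrix.sub_mul, Matrix.mul_smul, Matrix.smul_mul, Matrix.mul_assoc,
    Matrix.one_mul]

/-- Here `xⱼ = R yⱼ`, and the inverse of the shifted Gram matrix is `R⁻ᵀ (A - c)⁻¹ R⁻¹`, so `R`
cancels in every quadratic form. Inserting `XXᵀ = RRᵀ` achieves the same cancellation in the traces
and in the square of the inverse. -/
theorem lowerGain_eq_gainMatrix {V : Matrix (Fin m) (Fin n) ℝ} (hV : Vᵀ * V = 1)
    {R : Matrix (Fin n) (Fin n) ℝ} (hR : IsUnit R) (s : Fin m → ℝ) (L : ℝ) (j : Fin m) :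
    lowerGain (V j) 1 (Vᵀ * diagonal s * V) L
      = (R * Vᵀ)ᵀ j ⬝ᵥ (gainMatrix (R * Vᵀ) s L *ᵥ (R * Vᵀ)ᵀ j) := by
  have hR' := (Matrix.isUnit_iff_isUnit_det _).1 hR
  have hRi : R⁻¹ * R = 1 := Matrix.nonsing_inv_mul _ hR'
  have hRi' : Rᵀ * (Rᵀ)⁻¹ = 1 := Matrix.mul_nonsing_inv _ (by rwa [det_transpose])
  have hG : (R * Vᵀ) * (R * Vᵀ)ᵀ = R * Rᵀ := by
    rw [transpose_mul, transpose_transpose, Matrix.mul_assoc, ← Matrix.mul_assoc Vᵀ, hV,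
      Matrix.one_mul]
  have hx : (R * Vᵀ)ᵀ j = R *ᵥ V j := by
    rw [transpose_mul, transpose_transpose]
    ext i
    simp [Matrix.mul_apply, mulVec, dotProduct, mul_comm]
  have hN : ∀ c, (shiftedGram (R * Vᵀ) s c)⁻¹
      = (Rᵀ)⁻¹ * (Vᵀ * diagonal s * V - c • (1 : Matrix (Fin n) (Fin n) ℝ))⁻¹ * R⁻¹ := by
    intro c
    rw [shiftedGram_mul_transpose hV, Matrix.mul_inv_rev, Matrix.mul_inv_rev,
      Matrix.mul_assoc (Rᵀ)⁻¹]
  have htr : ∀ c, ((shiftedGram (R * Vᵀ) s c)⁻¹ * (R * Rᵀ)).trace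
      = lowerPotential c (Vᵀ * diagonal s * V) := by
    intro c
    rw [hN, lowerPotential, Matrix.mul_assoc, ← Matrix.mul_assoc R⁻¹, hRi, Matrix.one_mul,
      Matrix.mul_assoc, Matrix.trace_mul_comm, Matrix.mul_assoc, hRi', Matrix.mul_one]
  have hq : ∀ N : Matrix (Fin n) (Fin n) ℝ,
      (R *ᵥ V j) ⬝ᵥ (((Rᵀ)⁻¹ * N * R⁻¹) *ᵥ (R *ᵥ V j)) = V j ⬝ᵥ (N *ᵥ V j) := by
    intro N
    rw [mulVec_mulVec, Matrix.mul_assoc, hRi, Matrix.mul_one, ← vecMul_transpose,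
      ← dotProduct_mulVec, mulVec_mulVec, ← Matrix.mul_assoc, hRi', Matrix.one_mul]
  simp only [lowerGain, gainMatrix]
  rw [hG, Matrix.sub_mul, trace_sub, htr, htr, hx, sub_mulVec, dotProduct_sub, smul_mulVec,
    dotProduct_smul, hN, hq]
  set N := (Vᵀ * diagonal s * V - (L + 1) • (1 : Matrix (Fin n) (Fin n) ℝ))⁻¹
  have e : (Rᵀ)⁻¹ * N * R⁻¹ * (R * Rᵀ * ((Rᵀ)⁻¹ * N * R⁻¹)) = (Rᵀ)⁻¹ * (N * N) * R⁻¹ := by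
    calc _ = (Rᵀ)⁻¹ * N * (R⁻¹ * R) * (Rᵀ * (Rᵀ)⁻¹) * N * R⁻¹ := by
          simp only [Matrix.mul_assoc]
      _ = _ := by rw [hRi, hRi', Matrix.mul_one, Matrix.mul_one]; simp only [Matrix.mul_assoc]
  rw [e, hq, smul_eq_mul, inv_mul_eq_div]

theorem posDef_shiftedGram {V : Matrix (Fin m) (Fin n) ℝ} (hV : Vᵀ * V = 1)
    {R : Matrix (Fin n) (Fin n) ℝ} (hR : IsUnit R) {s : Fin m → ℝ} {c : ℝ}
    (h : (Vᵀ * diagonal s * V - c • (1 : Matrix (Fin n) (Fin n) ℝ)).PosDef) :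
    (shiftedGram (R * Vᵀ) s c).PosDef := by
  rw [shiftedGram_mul_transpose hV]
  simpa [Matrix.star_eq_conjTranspose] using (Matrix.IsUnit.posDef_star_right_conjugate_iff hR).2 h

end DualSet

/-! ### Inversion by successive replacement of rows -/

section RowReplacement

open Matrix

variable {n : ℕ}

/-- The first `p` rows of `M`, followed by rows of the identity matrix. -/
def topRows (M : Matrix (Fin n) (Fin n) ℝ) (p : ℕ) : Matrix (Fin n) (Fin n) ℝ :=
  fun i => if (i : ℕ) < p then M i else (1 : Matrix (Fin n) (Fin n) ℝ) i

theorem topRows_zero (M : Matrix (Fin n) (Fin n) ℝ) : topRows M 0 = 1 := by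
  ext i j; simp [topRows]

theorem topRows_self (M : Matrix (Fin n) (Fin n) ℝ) : topRows M n = M := by
  ext i j; simp [topRows]

theorem topRows_succ (M : Matrix (Fin n) (Fin n) ℝ) (p : Fin n) :
    topRows M (p + 1)
      = topRows M p + vecMulVec (Pi.single p 1) (M p - (1 : Matrix (Fin n) (Fin n) ℝ) p) := by
  ext i j
  rcases lt_trichotomy i p with h | rfl | h
  · have h1 : (i : ℕ) < p := h
    simp [topRows, h1, h1.trans (Nat.lt_succ_self _), vecMulVec_apply, h.ne]
  · simp [topRows, vecMulVec_apply]
  · have h1 : ¬ (i : ℕ) < p := not_lt.2 h.le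
    have h2 : ¬ (i : ℕ) < p + 1 := by simpa [Nat.lt_succ_iff] using h
    simp [topRows, h1, h2, vecMulVec_apply, h.ne']

/-- A kernel vector `x` vanishes in the coordinates from `p` on, while `Mx` vanishes in those before
`p`; hence `xᵀMx = 0`, and definiteness gives `x = 0`. -/
theorem isUnit_topRows {M : Matrix (Fin n) (Fin n) ℝ} (hM : M.PosDef) (p : ℕ) :
    IsUnit (topRows M p) := by
  refine Matrix.mulVec_injective_iff_isUnit.1 ?_
  refine (injective_iff_map_eq_zero (topRows M p).mulVecLin).2 fun x hx => ?_
  by_contra hx0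
  have h1 := hM.dotProduct_mulVec_pos hx0
  refine h1.ne' (Finset.sum_eq_zero fun i _ => ?_)
  have h2 : (topRows M p *ᵥ x) i = 0 := congrFun hx i
  by_cases hi : (i : ℕ) < p
  · have : (topRows M p *ᵥ x) i = (M *ᵥ x) i := by simp [mulVec, topRows, hi]
    rw [← this, h2, mul_zero]
  · have : (topRows M p *ᵥ x) i = ((1 : Matrix (Fin n) (Fin n) ℝ) *ᵥ x) i := by
      simp [mulVec, topRows, hi]
    rw [this, one_mulVec] at h2
    simp [h2]

theorem inv_add_vecMulVec_single {P : Matrix (Fin n) (Fin n) ℝ} {p : Fin n} {r : Fin n → ℝ}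
    (hP : IsUnit P) (hP' : IsUnit (P + vecMulVec (Pi.single p 1) r)) (i j : Fin n) :
    (P + vecMulVec (Pi.single p 1) r)⁻¹ i j
      = P⁻¹ i j - P⁻¹ i p * (r ᵥ* P⁻¹) j / (1 + (r ᵥ* P⁻¹) p) := by
  have hd := (Matrix.isUnit_iff_isUnit_det _).1 hP
  set w := r ᵥ* P⁻¹ with hw
  set c := P⁻¹ *ᵥ Pi.single p 1 with hc
  have hrc : r ⬝ᵥ c = w p := by rw [hc, dotProduct_mulVec]; simp [hw]
  have hPc : P *ᵥ c = Pi.single p 1 := by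
    rw [hc, mulVec_mulVec, Matrix.mul_nonsing_inv _ hd, one_mulVec]
  -- Were the denominator zero, the nonzero vector `c = P⁻¹ eₚ` would be in the kernel of the
  -- updated matrix.
  have hne : 1 + w p ≠ 0 := by
    intro h0
    have h1 : (P + vecMulVec (Pi.single p 1) r) *ᵥ c = 0 := by
      rw [add_mulVec, hPc, vecMulVec_mulVec, hrc]
      ext i
      rcases eq_or_ne i p with rfl | hi
      · simpa using h0
      · simp [hi]
    have h2 : c = 0 := Matrix.mulVec_injective_of_isUnit hP' (by rw [h1, mulVec_zero])
    rw [h2, mulVec_zero] at hPc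
    simpa using congrFun hPc p
  have hwP : w ᵥ* P = r := by
    rw [hw, vecMul_vecMul, Matrix.nonsing_inv_mul _ hd, vecMul_one]
  have key : (P⁻¹ - (1 + w p)⁻¹ • vecMulVec c w) * (P + vecMulVec (Pi.single p 1) r) = 1 := by
    have e1 : P⁻¹ * vecMulVec (Pi.single p 1) r = vecMulVec c r := by rw [mul_vecMulVec]
    have e2 : vecMulVec c w * vecMulVec (Pi.single p 1) r = w p • vecMulVec c r := by
      rw [vecMulVec_mul_vecMulVec, vecMulVec_smul]; simp
    have e3 : vecMulVec c r + w p • vecMulVec c r = (1 + w p) • vecMulVec c r := by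
      rw [add_smul, one_smul]
    rw [Matrix.sub_mul, Matrix.mul_add, Matrix.mul_add, Matrix.nonsing_inv_mul _ hd, e1,
      Matrix.smul_mul, Matrix.smul_mul, e2, vecMulVec_mul, hwP, ← smul_add,
      e3, smul_smul, inv_mul_cancel₀ hne, one_smul, add_sub_cancel_right]
  rw [Matrix.inv_eq_left_inv key]
  simp [vecMulVec_apply, hc]
  ring

end RowReplacement

/-! ### Reasoning about programs -/

namespace RealRAM

/-- Run from `s`, the program `c` ends in a store satisfying `Q` after at most `K` operations. -/
def Spec (c : Prog) (s : Store) (K : ℕ) (Q : Store → Prop) : Prop :=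
  Q (c.run s).1 ∧ (c.run s).2 ≤ K

theorem Spec.seq {c₁ c₂ : Prog} {s : Store} {K₁ K₂ : ℕ} {P Q : Store → Prop}
    (h₁ : Spec c₁ s K₁ P) (h₂ : ∀ s', P s' → Spec c₂ s' K₂ Q) : Spec (c₁.seq c₂) s (K₁ + K₂) Q :=
  ⟨(h₂ _ h₁.1).1, Nat.add_le_add h₁.2 (h₂ _ h₁.1).2⟩

theorem Spec.mono {c : Prog} {s : Store} {K K' : ℕ} {Q Q' : Store → Prop}
    (h : Spec c s K Q) (hK : K ≤ K') (hQ : ∀ s', Q s' → Q' s') : Spec c s K' Q' :=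
  ⟨hQ _ h.1, h.2.trans hK⟩

theorem Spec.loop {x : ℕ} {d : NExp} {c : Prog} {s : Store} {K p : ℕ} (I : ℕ → Store → Prop)
    (hp : d.eval s = p) (h0 : I 0 s)
    (hstep : ∀ i < p, ∀ s', I i s' → Spec c (s'.setReg x i) K (I (i + 1))) :
    Spec (Prog.loop x d c) s (d.cost + 1 + p * (K + 1)) (I p) := by
  subst hp
  have key : ∀ q ≤ d.eval s,
      I q ((List.range q).foldl (fun p i =>
        ((c.run (p.1.setReg x i)).1, p.2 + (c.run (p.1.setReg x i)).2 + 1))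
        (s, d.cost + 1)).1 ∧
      ((List.range q).foldl (fun p i =>
        ((c.run (p.1.setReg x i)).1, p.2 + (c.run (p.1.setReg x i)).2 + 1))
        (s, d.cost + 1)).2 ≤ d.cost + 1 + q * (K + 1) := by
    intro q
    induction q with
    | zero => intro _; simpa using h0
    | succ q ih =>
      intro hq
      obtain ⟨h1, h2⟩ := ih (by omega)
      obtain ⟨h3, h4⟩ := hstep q (by omega) _ h1
      rw [List.range_succ, List.foldl_append]
      refine ⟨h3, ?_⟩
      simp only [List.foldl_cons, List.foldl_nil]
      rw [Nat.succ_mul]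
      omega
  exact key _ le_rfl

/-- The stores `s` and `s'` agree outside the registers in `R` and the arrays in `A`. -/
structure Frame (R A : Finset ℕ) (s s' : Store) : Prop where
  reg : ∀ r, r ∉ R → s'.reg r = s.reg r
  arr : ∀ a, a ∉ A → s'.arr a = s.arr a

section Frame

variable {R A R' A' : Finset ℕ} {s s' t : Store}

theorem Frame.refl : Frame R A s s := ⟨fun _ _ => rfl, fun _ _ => rfl⟩

theorem Frame.trans (h : Frame R A s s') (h' : Frame R A s' t) : Frame R A s t :=
  ⟨fun r hr => (h'.reg r hr).trans (h.reg r hr), fun a ha => (h'.arr a ha).trans (h.arr a ha)⟩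

theorem Frame.mono (h : Frame R A s s') (hR : R ⊆ R') (hA : A ⊆ A') : Frame R' A' s s' :=
  ⟨fun r hr => h.reg r fun hr' => hr (hR hr'), fun a ha => h.arr a fun ha' => ha (hA ha')⟩

theorem Frame.setReg {x v : ℕ} (hx : x ∈ R) : Frame R A s (s.setReg x v) :=
  ⟨fun r hr => Function.update_of_ne (fun h : r = x => hr (h ▸ hx)) _ _, fun _ _ => rfl⟩

theorem Frame.setCell {a i j : ℕ} {r : ℝ} (ha : a ∈ A) : Frame R A s (s.setCell a i j r) := by
  refine ⟨fun _ _ => rfl, fun b hb => ?_⟩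
  have : b ≠ a := fun h => hb (h ▸ ha)
  funext i' j'
  simp [Store.setCell, this]

end Frame

/-- The upper left corner of array `a` holds the matrix `M`. -/
def HasMat {p q : ℕ} (s : Store) (a : ℕ) (M : Matrix (Fin p) (Fin q) ℝ) : Prop :=
  ∀ (i : Fin p) (j : Fin q), s.arr a i j = M i j

theorem HasMat.frame {p q : ℕ} {R A : Finset ℕ} {s s' : Store} {a : ℕ}
    {M : Matrix (Fin p) (Fin q) ℝ} (h : HasMat s a M) (hf : Frame R A s s') (ha : a ∉ A) :
    HasMat s' a M := fun i j => by rw [hf.arr a ha]; exact h i j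

/-! ### Filling an array -/

/-- Assign the value of `e`, which may refer to the registers `4` and `5`, to the entry of array
`a` in row number `4` and column number `5`, for all rows less than `d₁` and columns less than
`d₂`. -/
def fill (a : ℕ) (d₁ d₂ : NExp) (e : RExp) : Prog :=
  .loop 4 d₁ (.loop 5 d₂ (.setR a (.var 4) (.var 5) e))

/-- The conditions on `d₂` and `e` range over all stores that differ from `s` only in the two
counters and in array `a`, since these change while the loops run. In effect `e` must not depend on
the contents of `a`. -/
theorem spec_fill {a p q c : ℕ} {d₁ d₂ : NExp} {e : RExp} {s : Store}
    (M : Matrix (Fin p) (Fin q) ℝ) (hc₁ : d₁.cost = 1) (hc₂ : d₂.cost = 1) (h₁ : d₁.eval s = p)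
    (h₂ : ∀ s', Frame {4, 5} {a} s s' → d₂.eval s' = q)
    (he : ∀ s' (i : Fin p) (j : Fin q), Frame {4, 5} {a} s s' → s'.reg 4 = i → s'.reg 5 = j →
      e.eval s' = M i j ∧ e.cost s' ≤ c) :
    Spec (fill a d₁ d₂ e) s (2 + p * (3 + q * (c + 4)))
      fun s' => Frame {4, 5} {a} s s' ∧ HasMat s' a M := by
  refine (Spec.loop (fun r s' => Frame {4, 5} {a} s s' ∧
    ∀ (i : Fin p) (j : Fin q), (i : ℕ) < r → s'.arr a i j = M i j) h₁
    ⟨Frame.refl, fun i _ hi => absurd hi (Nat.not_lt_zero _)⟩ fun r hr s₁ hs₁ => ?_).mono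
    (K := d₁.cost + 1 + p * ((d₂.cost + 1 + q * (c + 3 + 1)) + 1)) ?_
    fun s' hs' => ⟨hs'.1, fun i j => hs'.2 i j i.2⟩
  swap
  · rw [hc₁, hc₂]
    exact le_of_eq (by ring)
  have hf₁ : Frame {4, 5} {a} s (s₁.setReg 4 r) := hs₁.1.trans (Frame.setReg (by simp))
  -- The entries lexicographically before `(r, t)` are already correct.
  refine (Spec.loop (K := c + 3) (fun t s' => Frame {4, 5} {a} s s' ∧ s'.reg 4 = r ∧
    ∀ (i : Fin p) (j : Fin q), ((i : ℕ) < r ∨ (i : ℕ) = r ∧ (j : ℕ) < t) → s'.arr a i j = M i j)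
    (h₂ _ hf₁) ⟨hf₁, by simp [Store.setReg], fun i j hij => hs₁.2 i j (by omega)⟩
    fun t ht s₂ hs₂ => ?_).mono le_rfl
    fun s' hs' => ⟨hs'.1, fun i j hi => hs'.2.2 i j (by omega)⟩
  have hf₂ : Frame {4, 5} {a} s (s₂.setReg 5 t) := hs₂.1.trans (Frame.setReg (by simp))
  have h4 : (s₂.setReg 5 t).reg 4 = r := by simp [Store.setReg, hs₂.2.1]
  have h5 : (s₂.setReg 5 t).reg 5 = t := by simp [Store.setReg]
  obtain ⟨hv, hc⟩ := he _ ⟨r, hr⟩ ⟨t, ht⟩ hf₂ h4 h5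
  refine ⟨⟨hf₂.trans (Frame.setCell (by simp)), h4, fun i j hij => ?_⟩, ?_⟩
  · simp only [Prog.run, NExp.eval, h4, h5, hv, Store.setCell, true_and]
    split_ifs with hc
    · congr 1 <;> exact Fin.ext (by simp [hc])
    · exact hs₂.2.2 i j (by omega)
  · simp only [Prog.run, NExp.cost]
    omega

/-! ### Inverting a positive definite matrix -/

/-- Invert the square matrix in array `src`, whose size is in register `0`; the result is in array
`dst`. Starting from the identity matrix, its rows are replaced by those of the given matrix, and
the inverse is updated by the Sherman–Morrison formula. -/
def invert (src dst : ℕ) : Prog :=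
  .seq (fill dst (.var 0) (.var 0) (.ofNat (.lit 0))) <|
  .seq (.loop 6 (.var 0) (.setR dst (.var 6) (.var 6) (.ofNat (.lit 1)))) <|
  .loop 6 (.var 0) <|
    .seq (fill 4 (.lit 1) (.var 0)
      (.sub (.sum 7 (.var 0) (.mul (.cell src (.var 6) (.var 7)) (.cell dst (.var 7) (.var 5))))
        (.cell dst (.var 6) (.var 5)))) <|
    .seq (fill 5 (.var 0) (.var 0)
      (.sub (.cell dst (.var 4) (.var 5))
        (.div (.mul (.cell dst (.var 4) (.var 6)) (.cell 4 (.lit 0) (.var 5)))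
          (.add (.ofNat (.lit 1)) (.cell 4 (.lit 0) (.var 6)))))) <|
    fill dst (.var 0) (.var 0) (.cell 5 (.var 4) (.var 5))

/-- Each of the `n` row replacements costs `O(n²)`. Array `5` is a buffer: the update of an entry
reads row `p` (through array `4`) and column `p` of the old inverse, so it cannot be done in place
by `fill`. -/
theorem spec_invert {n src dst : ℕ} {s : Store} {M : Matrix (Fin n) (Fin n) ℝ} (hM : M.PosDef)
    (hn : s.reg 0 = n) (hs : HasMat s src M) (hsd : src ≠ dst)
    (hs4 : src ≠ 4) (hs5 : src ≠ 5) (hd4 : dst ≠ 4) (hd5 : dst ≠ 5) :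
    Spec (invert src dst) s (40 * n ^ 3 + 40 * n ^ 2 + 40 * n + 40)
      fun s' => Frame {4, 5, 6} {4, 5, dst} s s' ∧ HasMat s' dst M⁻¹ := by
  have step : Spec (invert src dst) s
      ((2 + n * (3 + n * (2 + 4))) + ((1 + 1 + n * (5 + 1)) +
        (1 + 1 + n * ((2 + 1 * (3 + n * (9 * n + 6 + 4)) +
        ((2 + n * (3 + n * (18 + 4))) + (2 + n * (3 + n * (3 + 4))))) + 1))))
      fun s' => Frame {4, 5, 6} {4, 5, dst} s s' ∧
      HasMat s' dst M⁻¹ := by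
    refine Spec.seq (spec_fill (c := 2) (0 : Matrix (Fin n) (Fin n) ℝ) rfl rfl hn
      (fun s' hf => (hf.reg 0 (by simp)).trans hn)
      (fun s' i j _ _ _ => by simp [RExp.eval, RExp.cost, NExp.eval, NExp.cost]))
      fun s₁ hs₁ => ?_
    obtain ⟨hf₁, hz⟩ := hs₁
    have hf₁' : Frame {4, 5, 6} {4, 5, dst} s s₁ := hf₁.mono (by simp) (by simp)
    refine Spec.seq (Spec.loop (K := 5) (p := n) (fun p s' => Frame {4, 5, 6} {4, 5, dst} s s' ∧
      ∀ i j : Fin n, s'.arr dst i j = if i = j ∧ (i : ℕ) < p then 1 else 0)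
      ((hf₁.reg 0 (by simp)).trans hn) ⟨hf₁', fun i j => by simpa using hz i j⟩
      fun p hp s' hs' => ?_) fun s₂ hs₂ => ?_
    · refine ⟨⟨(hs'.1.trans (Frame.setReg (by simp))).trans (Frame.setCell (by simp)),
        fun i j => ?_⟩, ?_⟩
      · have := hs'.2 i j
        simp only [Prog.run, NExp.eval, RExp.eval, Store.setCell, Store.setReg,
          Function.update_self, true_and, this, Nat.cast_one]
        have : ((i : ℕ) = p ∧ (j : ℕ) = p) ∨ (i = j ∧ (i : ℕ) < p) ↔ i = j ∧ (i : ℕ) < p + 1 := by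
          rw [Fin.ext_iff]; omega
        by_cases h1 : (i : ℕ) = p ∧ (j : ℕ) = p
        · rw [if_pos h1, if_pos (this.1 (Or.inl h1))]
        · rw [if_neg h1]
          exact if_congr (by tauto) rfl rfl
      · simp [Prog.run, RExp.cost, NExp.cost]
    obtain ⟨hf₂, hI⟩ := hs₂
    refine Spec.mono (Spec.loop (p := n) (fun p s' => Frame {4, 5, 6} {4, 5, dst} s s' ∧
      HasMat s' dst (topRows M p)⁻¹) ((hf₂.reg 0 (by simp)).trans hn)
      ⟨hf₂, fun i j => by simp [hI, topRows_zero, Matrix.one_apply]⟩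
      fun p hp s₃ hs₃ => ?_) le_rfl
      fun s' hs' => ⟨hs'.1, by have := hs'.2; rwa [topRows_self] at this⟩
    obtain ⟨hf₃, hN⟩ := hs₃
    set N := (topRows M p)⁻¹ with hNdef
    -- The row `r P⁻¹` of `inv_add_vecMulVec_single` for `r = Mₚ - eₚ`; it is computed as `Mₚ N`
    -- minus row `p` of `N`.
    set w : Fin n → ℝ := (M ⟨p, hp⟩ - (1 : Matrix (Fin n) (Fin n) ℝ) ⟨p, hp⟩) ᵥ* N with hw
    have hf₄ : Frame {4, 5, 6} {4, 5, dst} s (s₃.setReg 6 p) := hf₃.trans (Frame.setReg (by simp))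
    have h6 : (s₃.setReg 6 p).reg 6 = p := by simp [Store.setReg]
    have hN₄ : HasMat (s₃.setReg 6 p) dst N := hN
    set s₄ := s₃.setReg 6 p
    have hM₄ : HasMat s₄ src M := hs.frame hf₄ (by simp [hs4, hs5, hsd])
    have hn₄ : s₄.reg 0 = n := (hf₄.reg 0 (by simp)).trans hn
    refine Spec.seq (spec_fill (c := 9 * n + 6) (fun (_ : Fin 1) j => w j) rfl rfl rfl
      (fun s' hf => (hf.reg 0 (by simp)).trans hn₄) fun s' i j hf e4 e5 => ?_)
      fun s₅ hs₅ => ?_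
    · have a0 : s'.reg 0 = n := (hf.reg 0 (by simp)).trans hn₄
      have a6 : s'.reg 6 = p := (hf.reg 6 (by simp)).trans h6
      have aM : HasMat s' src M := hM₄.frame hf (by simp [hs4])
      have aN : HasMat s' dst N := hN₄.frame hf (by simp [hd4])
      have aM' : ∀ l : Fin n, s'.arr src p l = M ⟨p, hp⟩ l := fun l => aM ⟨p, hp⟩ l
      have aN' : ∀ l : Fin n, s'.arr dst p l = N ⟨p, hp⟩ l := fun l => aN ⟨p, hp⟩ l
      constructor
      · have e : w j = ∑ l, M ⟨p, hp⟩ l * N l j - N ⟨p, hp⟩ j := by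
          have h1 : ((1 : Matrix (Fin n) (Fin n) ℝ) ⟨p, hp⟩ ᵥ* N) j = N ⟨p, hp⟩ j :=
            congrFun (congrFun (Matrix.one_mul N) _) _
          rw [hw, Matrix.sub_vecMul]
          exact congrArg (fun x => (M ⟨p, hp⟩ ᵥ* N) j - x) h1
        simp [RExp.eval, NExp.eval, Store.setReg, a0, a6, e5, Finset.sum_range, aM', aN', e,
          show ∀ i j : Fin n, s'.arr dst i j = N i j from aN]
      · simp [RExp.cost, NExp.cost, NExp.eval, a0]
        omega
    obtain ⟨hf₅, hw₅⟩ := hs₅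
    have hn₅ : s₅.reg 0 = n := (hf₅.reg 0 (by simp)).trans hn₄
    have hN₅ : HasMat s₅ dst N := hN₄.frame hf₅ (by simp [hd4])
    have h6₅ : s₅.reg 6 = p := (hf₅.reg 6 (by simp)).trans h6
    refine Spec.seq (spec_fill (c := 18) (topRows M (p + 1))⁻¹ rfl rfl hn₅
      (fun s' hf => (hf.reg 0 (by simp)).trans hn₅) fun s' i j hf e4 e5 => ?_)
      fun s₆ hs₆ => ?_
    · have a6 : s'.reg 6 = p := (hf.reg 6 (by simp)).trans h6₅
      have aN : HasMat s' dst N := hN₅.frame hf (by simp [hd5])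
      have aw := hw₅.frame hf (by simp)
      have aw' : ∀ j : Fin n, s'.arr 4 0 j = w j := fun j => aw 0 j
      have awp : s'.arr 4 0 p = w ⟨p, hp⟩ := aw' ⟨p, hp⟩
      have aNp : s'.arr dst i p = N i ⟨p, hp⟩ := aN i ⟨p, hp⟩
      constructor
      · have h1 := topRows_succ M ⟨p, hp⟩
        have h2 := inv_add_vecMulVec_single (isUnit_topRows hM p)
          (h1 ▸ isUnit_topRows hM (p + 1)) i j
        simp only at h1
        rw [h1, h2]
        simp [RExp.eval, NExp.eval, e4, e5, a6, aw', awp, aNp, aN i j, hw, hNdef]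
      · simp [RExp.cost, NExp.cost]
    obtain ⟨hf₆, hN₆⟩ := hs₆
    have hn₆ : s₆.reg 0 = n := (hf₆.reg 0 (by simp)).trans hn₅
    refine Spec.mono (spec_fill (c := 3) (topRows M (p + 1))⁻¹ rfl rfl hn₆
      (fun s' hf => (hf.reg 0 (by simp)).trans hn₆) fun s' i j hf e4 e5 => ?_) le_rfl
      fun s₇ hs₇ => ⟨?_, hs₇.2⟩
    · have aN := hN₆.frame hf (by simp [hd5.symm])
      exact ⟨by simp [RExp.eval, NExp.eval, e4, e5, aN i j], by simp [RExp.cost, NExp.cost]⟩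
    · exact ((hf₄.trans (hf₅.mono (by simp) (by simp))).trans
        (hf₆.mono (by simp) (by simp))).trans (hs₇.1.mono (by simp) (by simp))
  refine step.mono ?_ fun _ h => h
  nlinarith [Nat.zero_le n, Nat.zero_le (n ^ 2), Nat.zero_le (n ^ 3)]

end RealRAM

/-! ### The selection program -/

namespace RealRAM

open Matrix DualSet

/-- `τ - √(n k)`. -/
def lowExp : RExp := .sub (.ofNat (.var 3)) (.sqrt (.mul (.ofNat (.var 0)) (.ofNat (.var 2))))

/-- `(1 + √(m / k)) / (1 - √(n / k))`. -/
def stepExp : RExp :=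
  .div (.add (.ofNat (.lit 1)) (.sqrt (.div (.ofNat (.var 1)) (.ofNat (.var 2)))))
    (.sub (.ofNat (.lit 1)) (.sqrt (.div (.ofNat (.var 0)) (.ofNat (.var 2)))))

/-- The product of `stepExp` and `τ + √(m k)`. -/
def topExp : RExp :=
  .mul stepExp (.add (.ofNat (.var 3)) (.sqrt (.mul (.ofNat (.var 1)) (.ofNat (.var 2)))))

/-- Entry of `X diag(s - c) Xᵀ`. -/
def shiftedGramExp (c : RExp) : RExp :=
  .sum 7 (.var 1) (.mul (.mul (.cell 0 (.var 4) (.var 7)) (.sub (.cell 1 (.var 7) (.lit 0)) c))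
    (.cell 0 (.var 5) (.var 7)))

/-- Compute the lower gains of all indices into row `0` of array `13`. -/
def lowerGains : Prog :=
  .seq (fill 6 (.var 0) (.var 0) (.sum 7 (.var 1)
    (.mul (.cell 0 (.var 4) (.var 7)) (.cell 0 (.var 5) (.var 7))))) <|
  .seq (fill 2 (.var 0) (.var 0) (shiftedGramExp lowExp)) <|
  .seq (invert 2 7) <|
  .seq (fill 2 (.var 0) (.var 0) (shiftedGramExp (.add lowExp (.ofNat (.lit 1))))) <|
  .seq (invert 2 8) <|
  .seq (fill 9 (.var 0) (.var 0) (.sum 7 (.var 0)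
    (.mul (.cell 6 (.var 4) (.var 7)) (.cell 8 (.var 7) (.var 5))))) <|
  .seq (fill 10 (.lit 1) (.lit 1) (.sum 7 (.var 0) (.sum 8 (.var 0)
    (.mul (.sub (.cell 8 (.var 7) (.var 8)) (.cell 7 (.var 7) (.var 8)))
      (.cell 6 (.var 8) (.var 7)))))) <|
  .seq (fill 11 (.var 0) (.var 0) (.sub (.div
    (.sum 7 (.var 0) (.mul (.cell 8 (.var 4) (.var 7)) (.cell 9 (.var 7) (.var 5))))
    (.cell 10 (.lit 0) (.lit 0))) (.cell 8 (.var 4) (.var 5)))) <|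
  fill 13 (.lit 1) (.var 1) (.sum 7 (.var 0) (.sum 8 (.var 0)
    (.mul (.mul (.cell 0 (.var 7) (.var 5)) (.cell 11 (.var 7) (.var 8)))
      (.cell 0 (.var 8) (.var 5)))))

/-- The reciprocal of `c - sⱼ`, where `j` is in register `x`. -/
def gapInvExp (c : RExp) (x : ℕ) : RExp :=
  .div (.ofNat (.lit 1)) (.sub c (.cell 1 (.var x) (.lit 0)))

/-- Compute the upper gains of all indices into row `0` of array `14`. -/
def upperGains : Prog :=
  .seq (fill 12 (.lit 1) (.lit 1) (.sum 7 (.var 1)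
    (.sub (gapInvExp topExp 7) (gapInvExp (.add topExp stepExp) 7)))) <|
  fill 14 (.lit 1) (.var 1) (.add
    (.div (.mul (gapInvExp (.add topExp stepExp) 5) (gapInvExp (.add topExp stepExp) 5))
      (.cell 12 (.lit 0) (.lit 0)))
    (gapInvExp (.add topExp stepExp) 5))

/-- Put the last index whose upper gain does not exceed its lower gain into register `9`. -/
def selectIndex : Prog :=
  .loop 5 (.var 1) (.ifLe (.cell 14 (.lit 0) (.var 5)) (.cell 13 (.lit 0) (.var 5))
    (.setN 9 (.var 5)) .skip)

/-- Update the weight of the selected index. -/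
def updateWeight : Prog :=
  .setR 1 (.var 9) (.lit 0) (.add (.cell 1 (.var 9) (.lit 0)) (.div (.ofNat (.lit 1))
    (.div (.add (.cell 14 (.lit 0) (.var 9)) (.cell 13 (.lit 0) (.var 9))) (.ofNat (.lit 2)))))

/-- One iteration. -/
def iteration : Prog := .seq lowerGains (.seq upperGains (.seq selectIndex updateWeight))

/-- The program that performs `k` iterations. -/
def greedySelection : Prog := .loop 3 (.var 2) iteration

/-- The input, the iteration number and the current weights are in their places. -/
structure Ctx {n m : ℕ} (X : Matrix (Fin n) (Fin m) ℝ) (w : Fin m → ℝ) (k τ : ℕ) (s : Store) :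
    Prop where
  reg0 : s.reg 0 = n
  reg1 : s.reg 1 = m
  reg2 : s.reg 2 = k
  reg3 : s.reg 3 = τ
  mat : HasMat s 0 X
  weights : ∀ j : Fin m, s.arr 1 j 0 = w j

section

variable {n m k τ : ℕ} {X : Matrix (Fin n) (Fin m) ℝ} {w : Fin m → ℝ} {s s' : Store}

theorem Ctx.frame {R A : Finset ℕ} (h : Ctx X w k τ s) (hf : Frame R A s s')
    (hR : ∀ r ∈ R, 4 ≤ r) (hA : ∀ a ∈ A, 2 ≤ a) : Ctx X w k τ s' := by
  have hR' : ∀ r < 4, r ∉ R := fun r hr h => absurd (hR r h) (by omega)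
  have hA' : ∀ a < 2, a ∉ A := fun a ha h => absurd (hA a h) (by omega)
  refine ⟨?_, ?_, ?_, ?_, h.mat.frame hf (hA' 0 (by norm_num)), fun j => ?_⟩
  · rw [hf.reg 0 (hR' 0 (by norm_num)), h.reg0]
  · rw [hf.reg 1 (hR' 1 (by norm_num)), h.reg1]
  · rw [hf.reg 2 (hR' 2 (by norm_num)), h.reg2]
  · rw [hf.reg 3 (hR' 3 (by norm_num)), h.reg3]
  · rw [hf.arr 1 (hA' 1 (by norm_num)), h.weights]

/-- The bound `12` is the cost of evaluating `L + 1`, the dearer of the two shifts. By `hc'` the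
shift does not depend on the summation register. -/
theorem spec_shiftedGram {c : RExp} {v : ℝ} (h : Ctx X w k τ s)
    (hc : ∀ s', Ctx X w k τ s' → c.eval s' = v ∧ c.cost s' ≤ 12)
    (hc' : ∀ s' i, c.eval (s'.setReg 7 i) = c.eval s' ∧ c.cost (s'.setReg 7 i) = c.cost s') :
    Spec (fill 2 (.var 0) (.var 0) (shiftedGramExp c)) s (2 + n * (3 + n * (26 * m + 2 + 4)))
      fun s' => Frame {4, 5} {2} s s' ∧ HasMat s' 2 (shiftedGram X w v) := by
  refine spec_fill _ rfl rfl h.reg0 (fun s' hf => (h.frame hf (by simp) (by simp)).reg0)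
    fun s' i j hf e4 e5 => ?_
  have h' := h.frame hf (by simp) (by simp)
  obtain ⟨hv, hcost⟩ := hc s' h'
  have hX : ∀ (i : Fin n) (j : Fin m), s'.arr 0 i j = X i j := h'.mat
  constructor
  · have e : shiftedGram X w v i j = ∑ l, X i l * (w l - v) * X j l := by
      rw [shiftedGram, Matrix.mul_apply]
      simp only [mul_diagonal, transpose_apply]
    simp only [shiftedGramExp, RExp.eval, hc', hv, e]
    simp [NExp.eval, Store.setReg, h'.reg1, e4, e5, Finset.sum_range, hX, h'.weights]
  · simp only [shiftedGramExp, RExp.cost, hc']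
    simp only [NExp.cost, NExp.eval, h'.reg1, Finset.sum_const, Finset.card_range, smul_eq_mul]
    nlinarith

/-- Computing the inverses afresh in every iteration is affordable because `n³ ≤ m n²`; the two
definiteness hypotheses are what the inversions need. -/
theorem spec_lowerGains (hn : 0 < n) (hnm : n ≤ m) (h : Ctx X w k τ s)
    (hL : (shiftedGram X w ((τ : ℝ) - √((n : ℝ) * k))).PosDef)
    (hL' : (shiftedGram X w ((τ : ℝ) - √((n : ℝ) * k) + 1)).PosDef) :
    Spec lowerGains s (600 * (m * n ^ 2)) fun s' =>
      Frame {4, 5, 6} {2, 4, 5, 6, 7, 8, 9, 10, 11, 13} s s' ∧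
      HasMat s' 13 (fun (_ : Fin 1) j =>
        Xᵀ j ⬝ᵥ (gainMatrix X w ((τ : ℝ) - √((n : ℝ) * k)) *ᵥ Xᵀ j)) := by
  set L : ℝ := (τ : ℝ) - √((n : ℝ) * k) with hLdef
  set N₀ := (shiftedGram X w L)⁻¹ with hN₀
  set N := (shiftedGram X w (L + 1))⁻¹ with hN
  have main : Spec lowerGains s
      ((2 + n * (3 + n * (9 * m + 2 + 4))) +
      ((2 + n * (3 + n * (26 * m + 2 + 4))) +
      ((40 * n ^ 3 + 40 * n ^ 2 + 40 * n + 40) +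
      ((2 + n * (3 + n * (26 * m + 2 + 4))) +
      ((40 * n ^ 3 + 40 * n ^ 2 + 40 * n + 40) +
      ((2 + n * (3 + n * (9 * n + 2 + 4))) +
      ((2 + 1 * (3 + 1 * (2 + n * (4 + 13 * n) + 4))) +
      ((2 + n * (3 + n * (9 * n + 10 + 4))) +
      (2 + 1 * (3 + m * (2 + n * (4 + 13 * n) + 4)))))))))))
      fun s' =>
      Frame {4, 5, 6} {2, 4, 5, 6, 7, 8, 9, 10, 11, 13} s s' ∧
      HasMat s' 13 (fun (_ : Fin 1) j => Xᵀ j ⬝ᵥ (gainMatrix X w L *ᵥ Xᵀ j)) := by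
    refine Spec.seq (spec_fill (X * Xᵀ) rfl rfl h.reg0
      (fun s' hf => (h.frame hf (by simp) (by simp)).reg0) fun s' i j hf e4 e5 => ?_)
      fun s₁ ⟨f₁, m₁⟩ => ?_
    · have h' := h.frame hf (by simp) (by simp)
      have hX : ∀ (i : Fin n) (j : Fin m), s'.arr 0 i j = X i j := h'.mat
      constructor
      · simp [RExp.eval, NExp.eval, Store.setReg, h'.reg1, e4, e5, Finset.sum_range, hX,
          Matrix.mul_apply]
      · simp [RExp.cost, NExp.cost, NExp.eval, h'.reg1]
        omega
    have h₁ := h.frame f₁ (by simp) (by simp)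
    refine Spec.seq (spec_shiftedGram (v := L) h₁ (fun s' h' => ?_)
      fun s' i => ⟨by simp [lowExp, RExp.eval, NExp.eval, Store.setReg], rfl⟩)
      fun s₂ ⟨f₂, m₂⟩ => ?_
    · simp [lowExp, RExp.eval, RExp.cost, NExp.eval, NExp.cost, h'.reg0, h'.reg2, h'.reg3, hLdef]
    have h₂ := h₁.frame f₂ (by simp) (by simp)
    refine Spec.seq (spec_invert hL h₂.reg0 m₂ (by norm_num) (by norm_num) (by norm_num)
      (by norm_num) (by norm_num)) fun s₃ ⟨f₃, m₃⟩ => ?_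
    have h₃ := h₂.frame f₃ (by simp) (by simp)
    refine Spec.seq (spec_shiftedGram (v := L + 1) h₃ (fun s' h' => ?_)
      fun s' i => ⟨by simp [lowExp, RExp.eval, NExp.eval, Store.setReg], rfl⟩)
      fun s₄ ⟨f₄, m₄⟩ => ?_
    · simp [lowExp, RExp.eval, RExp.cost, NExp.eval, NExp.cost, h'.reg0, h'.reg2, h'.reg3, hLdef]
    have h₄ := h₃.frame f₄ (by simp) (by simp)
    refine Spec.seq (spec_invert hL' h₄.reg0 m₄ (by norm_num) (by norm_num) (by norm_num)
      (by norm_num) (by norm_num)) fun s₅ ⟨f₅, m₅⟩ => ?_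
    have h₅ := h₄.frame f₅ (by simp) (by simp)
    have g₅ : HasMat s₅ 6 (X * Xᵀ) :=
      (((m₁.frame f₂ (by simp)).frame f₃ (by simp)).frame f₄ (by simp)).frame f₅ (by simp)
    have n₅ : HasMat s₅ 7 N₀ := (m₃.frame f₄ (by simp)).frame f₅ (by simp)
    refine Spec.seq (spec_fill ((X * Xᵀ) * N) rfl rfl h₅.reg0
      (fun s' hf => (h₅.frame hf (by simp) (by simp)).reg0) fun s' i j hf e4 e5 => ?_)
      fun s₆ ⟨f₆, m₆⟩ => ?_
    · have h' := h₅.frame hf (by simp) (by simp)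
      have hG : ∀ i j : Fin n, s'.arr 6 i j = (X * Xᵀ) i j := g₅.frame hf (by simp)
      have hNN : ∀ i j : Fin n, s'.arr 8 i j = N i j := m₅.frame hf (by simp)
      constructor
      · rw [Matrix.mul_apply]
        simp [RExp.eval, NExp.eval, Store.setReg, h'.reg0, e4, e5, Finset.sum_range, hG, hNN]
      · simp [RExp.cost, NExp.cost, NExp.eval, h'.reg0]
        omega
    have h₆ := h₅.frame f₆ (by simp) (by simp)
    have g₆ : HasMat s₆ 6 (X * Xᵀ) := g₅.frame f₆ (by simp)
    have n₆ : HasMat s₆ 7 N₀ := n₅.frame f₆ (by simp)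
    have p₆ : HasMat s₆ 8 N := m₅.frame f₆ (by simp)
    refine Spec.seq (spec_fill (p := 1) (q := 1)
      (fun _ _ => ((N - N₀) * (X * Xᵀ)).trace) rfl rfl rfl (fun _ _ => rfl)
      fun s' i j hf e4 e5 => ?_) fun s₇ ⟨f₇, m₇⟩ => ?_
    · have h' := h₆.frame hf (by simp) (by simp)
      have hG : ∀ i j : Fin n, s'.arr 6 i j = (X * Xᵀ) i j := g₆.frame hf (by simp)
      have hN₀ : ∀ i j : Fin n, s'.arr 7 i j = N₀ i j := n₆.frame hf (by simp)
      have hNN : ∀ i j : Fin n, s'.arr 8 i j = N i j := p₆.frame hf (by simp)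
      constructor
      · have e : ((N - N₀) * (X * Xᵀ)).trace
            = ∑ a, ∑ b, (N a b - N₀ a b) * (X * Xᵀ) b a := by
          simp only [Matrix.trace, diag_apply]
          exact Finset.sum_congr rfl fun a _ => Matrix.mul_apply
        rw [e]
        simp [RExp.eval, NExp.eval, Store.setReg, h'.reg0, Finset.sum_range, hG, hN₀, hNN]
      · simp [RExp.cost, NExp.cost, NExp.eval, Store.setReg, h'.reg0]
        nlinarith
    have h₇ := h₆.frame f₇ (by simp) (by simp)
    have p₇ : HasMat s₇ 8 N := p₆.frame f₇ (by simp)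
    have q₇ : HasMat s₇ 9 ((X * Xᵀ) * N) := m₆.frame f₇ (by simp)
    refine Spec.seq (spec_fill (gainMatrix X w L) rfl rfl h₇.reg0
      (fun s' hf => (h₇.frame hf (by simp) (by simp)).reg0) fun s' i j hf e4 e5 => ?_)
      fun s₈ ⟨f₈, m₈⟩ => ?_
    · have h' := h₇.frame hf (by simp) (by simp)
      have hNN : ∀ i j : Fin n, s'.arr 8 i j = N i j := p₇.frame hf (by simp)
      have hH : ∀ i j : Fin n, s'.arr 9 i j = ((X * Xᵀ) * N) i j := q₇.frame hf (by simp)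
      have hD : s'.arr 10 0 0 = ((N - N₀) * (X * Xᵀ)).trace := m₇.frame hf (by simp) 0 0
      constructor
      · have e : gainMatrix X w L i j = (∑ l, N i l * ((X * Xᵀ) * N) l j)
            / ((N - N₀) * (X * Xᵀ)).trace - N i j := by
          rw [div_eq_inv_mul]
          rfl
        rw [e]
        simp [RExp.eval, NExp.eval, Store.setReg, h'.reg0, Finset.sum_range, hH, hD, hNN, e4, e5]
      · simp [RExp.cost, NExp.cost, NExp.eval, h'.reg0]
        omega
    have h₈ := h₇.frame f₈ (by simp) (by simp)
    refine Spec.mono (spec_fill (p := 1) (q := m)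
      (fun _ j => Xᵀ j ⬝ᵥ (gainMatrix X w L *ᵥ Xᵀ j)) rfl rfl rfl
      (fun s' hf => (h₈.frame hf (by simp) (by simp)).reg1)
      fun s' i j hf e4 e5 => ?_) le_rfl fun s₉ ⟨f₉, m₉⟩ => ⟨?_, m₉⟩
    · have h' := h₈.frame hf (by simp) (by simp)
      have hX : ∀ (i : Fin n) (j : Fin m), s'.arr 0 i j = X i j := h'.mat
      have hK : ∀ i j : Fin n, s'.arr 11 i j = gainMatrix X w L i j := m₈.frame hf (by simp)
      constructor
      · simp [RExp.eval, NExp.eval, Store.setReg, h'.reg0, Finset.sum_range, hX, hK, e5,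
          dotProduct, mulVec, Finset.mul_sum, mul_assoc]
      · simp [RExp.cost, NExp.cost, NExp.eval, Store.setReg, h'.reg0]
        nlinarith
    · have mono : ∀ {R A : Finset ℕ} {s s' : Store}, Frame R A s s' → R ⊆ {4, 5, 6} →
          A ⊆ {2, 4, 5, 6, 7, 8, 9, 10, 11, 13} →
          Frame {4, 5, 6} {2, 4, 5, 6, 7, 8, 9, 10, 11, 13} s s' := fun f hR hA => f.mono hR hA
      exact (mono f₁ (by decide) (by decide)).trans <| (mono f₂ (by decide) (by decide)).trans <|
        (mono f₃ (by decide) (by decide)).trans <| (mono f₄ (by decide) (by decide)).trans <|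
        (mono f₅ (by decide) (by decide)).trans <| (mono f₆ (by decide) (by decide)).trans <|
        (mono f₇ (by decide) (by decide)).trans <| (mono f₈ (by decide) (by decide)).trans <|
        mono f₉ (by decide) (by decide)
  refine main.mono ?_ fun _ h => h
  have b1 : n ^ 3 ≤ m * n ^ 2 := by
    rw [pow_succ, mul_comm]; exact Nat.mul_le_mul_right _ hnm
  have b2 : n ^ 2 ≤ n ^ 3 := Nat.pow_le_pow_right hn (by norm_num)
  have b3 : n ≤ n ^ 2 := Nat.le_self_pow (by norm_num) n
  have b4 : m * n ≤ m * n ^ 2 := Nat.mul_le_mul_left _ b3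
  have b5 : m ≤ m * n := Nat.le_mul_of_pos_right _ hn
  nlinarith

end

end RealRAM

/-! ### Upper gains, choice of the index, and the complete loop -/

namespace RealRAM

open Matrix DualSet

section

variable {n m k τ : ℕ} {X : Matrix (Fin n) (Fin m) ℝ} {w : Fin m → ℝ} {s s' : Store}

theorem Ctx.eval_gapInvExp_topExp {x : ℕ} {j : Fin m} (h : Ctx X w k τ s) (hx : s.reg x = j) :
    (gapInvExp topExp x).eval s
      = (upperStep n m k * ((τ : ℝ) + √((m : ℝ) * k)) - w j)⁻¹ := by
  simp only [gapInvExp, topExp, stepExp, upperStep, RExp.eval, NExp.eval, h.reg0, h.reg1, h.reg2,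
    h.reg3, hx, h.weights, Nat.cast_one, one_div]

theorem Ctx.eval_gapInvExp_add {x : ℕ} {j : Fin m} (h : Ctx X w k τ s) (hx : s.reg x = j) :
    (gapInvExp (.add topExp stepExp) x).eval s
      = (upperStep n m k * ((τ : ℝ) + √((m : ℝ) * k)) + upperStep n m k - w j)⁻¹ := by
  simp only [gapInvExp, topExp, stepExp, upperStep, RExp.eval, NExp.eval, h.reg0, h.reg1, h.reg2,
    h.reg3, hx, h.weights, Nat.cast_one, one_div]

/-- No `m × m` matrix is formed: for diagonal `B` the gains are scalar expressions with a common
denominator, which is computed once. -/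
theorem spec_upperGains (hk : n < k) (h : Ctx X w k τ s)
    (hw : ∀ i, w i < upperStep n m k * ((τ : ℝ) + √((m : ℝ) * k))) :
    Spec upperGains s (400 * m + 400) fun s' =>
      Frame {4, 5} {12, 14} s s' ∧
      HasMat s' 14 (fun (_ : Fin 1) j => upperGain (Pi.single j 1) (upperStep n m k) (diagonal w)
        (upperStep n m k * ((τ : ℝ) + √((m : ℝ) * k)))) := by
  set δ := upperStep n m k with hδ
  set T := δ * ((τ : ℝ) + √((m : ℝ) * k)) with hT
  have main : Spec upperGains s
      ((2 + 1 * (3 + 1 * (95 * m + 2 + 4))) + (2 + 1 * (3 + m * (174 + 4)))) fun s' =>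
      Frame {4, 5} {12, 14} s s' ∧
      HasMat s' 14 (fun (_ : Fin 1) j => upperGain (Pi.single j 1) δ (diagonal w) T) := by
    refine Spec.seq (spec_fill (p := 1) (q := 1)
      (fun _ _ => ∑ i, (T - w i)⁻¹ - ∑ i, (T + δ - w i)⁻¹) rfl rfl rfl (fun _ _ => rfl)
      fun s' i j hf e4 e5 => ?_) fun s₁ ⟨f₁, m₁⟩ => ?_
    · have h' := h.frame hf (by simp) (by simp)
      constructor
      · rw [← Finset.sum_sub_distrib, RExp.eval]
        simp only [NExp.eval, h'.reg1, Finset.sum_range]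
        refine Finset.sum_congr rfl fun l _ => ?_
        have hl' : Ctx X w k τ (s'.setReg 7 l) :=
          h'.frame (R := {7}) (A := ∅) (Frame.setReg (by simp)) (by simp) (by simp)
        have h7 : (s'.setReg 7 l).reg 7 = (l : ℕ) := by simp [Store.setReg]
        rw [RExp.eval, hl'.eval_gapInvExp_topExp h7, hl'.eval_gapInvExp_add h7]
      · simp [gapInvExp, topExp, stepExp, RExp.cost, NExp.cost, NExp.eval, h'.reg1]
        omega
    have h₁ := h.frame f₁ (by simp) (by simp)
    refine Spec.mono (spec_fill (p := 1) (q := m)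
      (fun _ j => upperGain (Pi.single j 1) δ (diagonal w) T) rfl rfl rfl
      (fun s' hf => (h₁.frame hf (by simp) (by simp)).reg1)
      fun s' i j hf e4 e5 => ?_) le_rfl fun s₂ ⟨f₂, m₂⟩ => ⟨?_, m₂⟩
    · have h' := h₁.frame hf (by simp) (by simp)
      have hD : s'.arr 12 0 0 = ∑ i, (T - w i)⁻¹ - ∑ i, (T + δ - w i)⁻¹ :=
        m₁.frame hf (by simp) 0 0
      constructor
      · rw [upperGain_single_diagonal (upperStep_pos hk) hw]
        simp only [RExp.eval, h'.eval_gapInvExp_add e5, NExp.eval, hD]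
        rfl
      · simp [gapInvExp, topExp, stepExp, RExp.cost, NExp.cost]
    · exact (f₁.mono (by decide) (by decide)).trans (f₂.mono (by decide) (by decide))
  exact main.mono (by omega) fun _ h => h

theorem spec_selectIndex {lo up : Fin m → ℝ} (hm : s.reg 1 = m)
    (hlo : HasMat s 13 fun (_ : Fin 1) j => lo j) (hup : HasMat s 14 fun (_ : Fin 1) j => up j)
    (hex : ∃ j, up j ≤ lo j) :
    Spec selectIndex s (2 + m * 10) fun s' =>
      Frame {5, 9} ∅ s s' ∧ ∃ j : Fin m, s'.reg 9 = j ∧ up j ≤ lo j := by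
  -- The invariant is conditional, since register `9` is meaningless until an admissible index has
  -- been met; `hex` discharges the condition at the end.
  refine Spec.mono (Spec.loop (K := 9) (fun r s' => Frame {5, 9} ∅ s s' ∧
    ((∃ j : Fin m, (j : ℕ) < r ∧ up j ≤ lo j) → ∃ j : Fin m, s'.reg 9 = j ∧ up j ≤ lo j))
    hm ⟨Frame.refl, fun ⟨_, hj, _⟩ => absurd hj (Nat.not_lt_zero _)⟩ fun r hr s₁ hs₁ => ?_) le_rfl
    fun s' hs' => ⟨hs'.1, hs'.2 (hex.imp fun j hj => ⟨j.2, hj⟩)⟩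
  have hf : Frame {5, 9} ∅ s (s₁.setReg 5 r) := hs₁.1.trans (Frame.setReg (by simp))
  have h5 : (s₁.setReg 5 r).reg 5 = r := by simp [Store.setReg]
  have hl : (s₁.setReg 5 r).arr 13 0 r = lo ⟨r, hr⟩ := hlo.frame hf (by simp) 0 ⟨r, hr⟩
  have hu : (s₁.setReg 5 r).arr 14 0 r = up ⟨r, hr⟩ := hup.frame hf (by simp) 0 ⟨r, hr⟩
  by_cases hle : up ⟨r, hr⟩ ≤ lo ⟨r, hr⟩
  · simp only [Spec, Prog.run, RExp.eval, NExp.eval, h5, hl, hu, if_pos hle]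
    refine ⟨⟨hf.trans (Frame.setReg (by simp)), fun _ => ⟨⟨r, hr⟩, ?_, hle⟩⟩, ?_⟩
    · simp [Store.setReg]
    · simp [RExp.cost, NExp.cost]
  · simp only [Spec, Prog.run, RExp.eval, NExp.eval, h5, hl, hu, if_neg hle]
    refine ⟨⟨hf, fun ⟨j, hj, hjle⟩ => ?_⟩, ?_⟩
    · have hjr : (j : ℕ) ≠ r := fun e => hle (by
        have : j = ⟨r, hr⟩ := Fin.ext e
        rwa [this] at hjle)
      obtain ⟨i, hi, hile⟩ := hs₁.2 ⟨j, by omega, hjle⟩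
      exact ⟨i, by simpa [Store.setReg] using hi, hile⟩
    · simp [RExp.cost, NExp.cost]

theorem spec_iteration (hn : 0 < n) (hk : n < k) (hm : k ≤ m) (h : Ctx X w k τ s)
    (hL : (shiftedGram X w ((τ : ℝ) - √((n : ℝ) * k))).PosDef)
    (hL' : (shiftedGram X w ((τ : ℝ) - √((n : ℝ) * k) + 1)).PosDef)
    (hw : ∀ i, w i < upperStep n m k * ((τ : ℝ) + √((m : ℝ) * k))) {lo up : Fin m → ℝ}
    (hlo : ∀ j, lo j = Xᵀ j ⬝ᵥ (gainMatrix X w ((τ : ℝ) - √((n : ℝ) * k)) *ᵥ Xᵀ j))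
    (hup : ∀ j, up j = upperGain (Pi.single j 1) (upperStep n m k) (diagonal w)
        (upperStep n m k * ((τ : ℝ) + √((m : ℝ) * k))))
    (hex : ∃ j, up j ≤ lo j) :
    Spec iteration s (1500 * (m * n ^ 2)) fun s' =>
      ∃ j, up j ≤ lo j ∧ Ctx X (w + Pi.single j ((up j + lo j) / 2)⁻¹) k τ s' := by
  have main : Spec iteration s
      (600 * (m * n ^ 2) + ((400 * m + 400) + ((2 + m * 10) + 20))) fun s' =>
      ∃ j, up j ≤ lo j ∧ Ctx X (w + Pi.single j ((up j + lo j) / 2)⁻¹) k τ s' := by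
    refine Spec.seq (spec_lowerGains hn (hk.le.trans hm) h hL hL') fun s₁ ⟨f₁, m₁⟩ => ?_
    have h₁ := h.frame f₁ (by simp) (by simp)
    refine Spec.seq (spec_upperGains hk h₁ hw) fun s₂ ⟨f₂, m₂⟩ => ?_
    have h₂ := h₁.frame f₂ (by simp) (by simp)
    have l₂ : HasMat s₂ 13 fun (_ : Fin 1) j => lo j := by
      simp only [hlo]
      exact m₁.frame f₂ (by simp)
    have u₂ : HasMat s₂ 14 fun (_ : Fin 1) j => up j := by
      simp only [hup]
      exact m₂
    refine Spec.seq (spec_selectIndex h₂.reg1 l₂ u₂ hex) fun s₃ ⟨f₃, j, h9, hj⟩ => ?_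
    have h₃ := h₂.frame f₃ (by simp) (by simp)
    have l₃ : s₃.arr 13 0 j = lo j := l₂.frame f₃ (by simp) 0 j
    have u₃ : s₃.arr 14 0 j = up j := u₂.frame f₃ (by simp) 0 j
    refine ⟨⟨j, hj, h₃.reg0, h₃.reg1, h₃.reg2, h₃.reg3, ?_, fun i => ?_⟩, ?_⟩
    · exact h₃.mat.frame (R := ∅) (A := {1}) (Frame.setCell (by simp)) (by simp)
    · simp only [updateWeight, Prog.run, RExp.eval, NExp.eval, h9, l₃, u₃, Store.setCell,
        h₃.weights, true_and, and_true, Fin.val_inj]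
      rcases eq_or_ne i j with rfl | hij
      · simp
      · simp [hij]
    · simp [updateWeight, Prog.run, RExp.cost, NExp.cost]
  refine main.mono ?_ fun _ h => h
  have b1 : m ≤ m * n ^ 2 := Nat.le_mul_of_pos_right _ (pow_pos hn 2)
  have b2 : 1 ≤ m := by omega
  omega

theorem ctx_initStore (X : Matrix (Fin n) (Fin m) ℝ) (k : ℕ) : Ctx X 0 k 0 (initStore X k) := by
  refine ⟨rfl, rfl, rfl, rfl, fun i j => ?_, fun j => ?_⟩
  · simp [initStore]
  · simp [initStore]

/-- The store keeps only the weights; the invariant relates them to a reachable abstract state,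
whose `A` and `B` are determined by them. The matrix `V` occurs only in this relation, not in the
program. -/
theorem spec_greedySelection (hn : 0 < n) (hk : n < k) (hm : k ≤ m)
    {V : Matrix (Fin m) (Fin n) ℝ} (hV : IsRightSingularMatrix X V) :
    Spec greedySelection (initStore X k) (1503 * (k * m * n ^ 2)) fun s' =>
      ∃ st, Reachable V k k st ∧ ∀ j : Fin m, s'.arr 1 j 0 = st.s j := by
  have main : Spec greedySelection (initStore X k) (1 + 1 + k * (1500 * (m * n ^ 2) + 1))
      fun s' => ∃ st τ, Reachable V k k st ∧ Ctx X st.s k τ s' := by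
    -- The counter value `τ'` is left unspecified because register `3` is set to `τ` only on
    -- entering the body.
    refine Spec.loop (fun τ s' => ∃ st τ', Reachable V k τ st ∧ Ctx X st.s k τ' s') rfl
      ⟨_, 0, Reachable.zero, ctx_initStore X k⟩ fun τ _ s₁ ⟨st, τ', hst, h⟩ => ?_
    have h₁ : Ctx X st.s k τ (s₁.setReg 3 τ) := by
      refine ⟨?_, ?_, ?_, ?_, h.mat, h.weights⟩ <;>
        simp [Store.setReg, h.reg0, h.reg1, h.reg2]
    obtain ⟨hVV, R, hR, rfl⟩ := hV.exists_factorization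
    have hinv := hst.barrierInv hn hk hm
    have hL := hinv.posDef
    have hL' := posDef_sub_add_one hinv.posDef (hinv.lowerPotential_lt_one hk)
    rw [hinv.A_eq] at hL hL'
    refine Spec.mono (spec_iteration hn hk hm h₁ (posDef_shiftedGram hVV hR hL)
      (posDef_shiftedGram hVV hR hL') hinv.lt
      (lo := fun j => lowerGain (V j) 1 st.A ((τ : ℝ) - √((n : ℝ) * k)))
      (up := fun j => upperGain (Pi.single j 1) (upperStep n m k) st.B
        (upperStep n m k * ((τ : ℝ) + √((m : ℝ) * k))))
      (fun j => by rw [hinv.A_eq]; exact lowerGain_eq_gainMatrix hVV hR _ _ _)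
      (fun j => by rw [hinv.B_eq]) (hinv.exists_index hn hk hm hVV)) le_rfl
      fun s₂ ⟨j, hj, h₂⟩ => ⟨_, τ, hst.succ ⟨j, hj, rfl⟩, h₂⟩
  refine main.mono ?_ fun s' ⟨st, τ, hst, h⟩ => ⟨st, hst, h.weights⟩
  -- The overhead `k + 2` of the loop is at most `3 k m n²`, whence the constant `1503`.
  have b1 : 1 ≤ k := hn.trans hk
  have b2 : k ≤ k * m * n ^ 2 := by
    rw [mul_assoc]
    exact Nat.le_mul_of_pos_right _ (Nat.mul_pos (by omega) (pow_pos hn 2))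
  nlinarith

end

end RealRAM

/-! ### The main theorem -/

theorem theorem2 :
    -- a single program that carries out the algorithm, and a single constant
    ∃ (P : RealRAM.Prog) (C : ℕ), ∀ (n m k : ℕ), 0 < n → n < k → k ≤ m →
      ∀ X : Matrix (Fin n) (Fin m) ℝ, X.rank = n →
        P.opCount X k ≤ C * (k * m * n ^ 2) ∧
        (∃ V : Matrix (Fin m) (Fin n) ℝ, IsRightSingularMatrix X V) ∧
        ∀ V : Matrix (Fin m) (Fin n) ℝ, IsRightSingularMatrix X V →
          IsGreedySelection V k (P.output X k) ∧
          ∀ S : Finset (Fin m), IsGreedySelection V k S →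
            S.card ≤ k ∧
            (colSubmatrix X S).rank = n ∧
            spectralNorm₂ (pinv (colSubmatrix X S)) ^ 2 ≤
              (1 + √((m : ℝ) / k)) ^ 2 * ((1 - √((n : ℝ) / k)) ^ 2)⁻¹ *
                spectralNorm₂ (pinv X) ^ 2 ∧
            frobeniusNorm (pinv (colSubmatrix X S)) ^ 2 ≤
              (1 + √((m : ℝ) / k)) ^ 2 * ((1 - √((n : ℝ) / k)) ^ 2)⁻¹ *
                frobeniusNorm (pinv X) ^ 2 := by
  refine ⟨RealRAM.greedySelection, 1503, fun n m k hn hk hm X hX => ?_⟩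
  obtain ⟨V₀, hV₀⟩ := exists_isRightSingularMatrix hX
  -- The operation count does not involve `V`, so any one decomposition serves to bound it.
  refine ⟨(RealRAM.spec_greedySelection hn hk hm hV₀).2, ⟨V₀, hV₀⟩, fun V hV =>
    ⟨?_, fun S hS => hS.guarantee hn hk hm hX hV⟩⟩
  obtain ⟨st, hst, hs⟩ := (RealRAM.spec_greedySelection hn hk hm hV).1
  exact (DualSet.isGreedySelection_iff hk).2 ⟨st, hst, fun i => by simp [RealRAM.Prog.output, hs]⟩
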